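/- Let $m\ge 1$ and let $B, A_{-1}, A_0, A_1$ be real $m\times m$ matrices such that the infinite matrix $$P=\begin{bmatrix} B&A_1\\ A_{-1}&A_0&A_1\\ &A_{-1}&A_0&\ddots\\ &&\ddots&\ddots\end{bmatrix}$$ is row-stochastic, i.e. the transition matrix of a quasi-birth-and-death (QBD) process on $\mathbb N\times\{1,\dots,m\}$. Assume that $P$ and $A_{-1}+A_0+A_1$ are irreducible, and that the doubly infinite QBD on $\mathbb Z\times\{1,\dots,m\}$ (with transition blocks $A_{-1},A_0,A_1$ for one level down, same level, one level up) has only one final class, of the form $\mathbb Z\times\mathcal E_*$ with $\mathcal E_*\neq\emptyset$, every other state being on a path to it. Let $G$ and $R$ be the minimal (entrywise) nonnegative solutions of $$A_{-1}+(A_0-I)X+A_1X^2=0\qquad\text{and}\qquad A_1+X(A_0-I)+X^2A_{-1}=0,$$ and put $U=A_0+RA_{-1}$ and $P_*=B+A_1G$. Let $(\boldsymbol g_k)_{k\ge0}$ be vectors of length $m$ with real or complex entries such that $\sum_{k\ge0}\rho(R)^k\|\boldsymbol g_k\|$ converges, where $\rho(R)$ is the spectral radius. If the QBD is recurrent, assume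 in addition that $\boldsymbol\pi_*^T\sum_{k\ge0}R^k\boldsymbol g_k=0$, where $\boldsymbol\pi_*$ is the stationary distribution of $P_*$: $\boldsymbol\pi_*^T(I-P_*)=\boldsymbol 0$, $\boldsymbol\pi_*^T\boldsymbol 1=1$. Then $U-I$ is nonsingular, the group inverse $(I-P_*)^{\#}$ exists, the series below converge, and for every scalar $c$ the vectors $$\boldsymbol\omega_r=G^r\boldsymbol\gamma+\boldsymbol y_r+c\boldsymbol 1,\quad r\ge0,\qquad \boldsymbol\gamma=(I-P_*)^{\#}\sum_{k=0}^\infty R^k\boldsymbol g_k,\qquad \boldsymbol y_r=-\sum_{k=0}^\infty\sum_{j=0}^{r-1}G^j(U-I)^{-1}R^k\boldsymbol g_{r+k-j},$$ form a solution $\boldsymbol\omega=(\boldsymbol\omega_r)_{r\ge0}$ of the Poisson equation $(I-P)\boldsymbol\omega=\boldsymbol g$ with $\boldsymbol g=(\boldsymbol g_r)_{r\ge0}$. This holds whether the QBD is positive recurrent, null recurrent or transient. (Here the group inverse $H^{\#}$ of $H$ is the matrix with $HH^{\#}=H^{\#}H$, $HH^{\#}H=H$, $H^{\#}HH^{\#}=H^{\#}$.)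 -/

import Mathlib

open scoped Matrix

noncomputable section

namespace QBD

/-! ### Markov chains on a discrete state space -/

section Chains

variable {S : Type*}

/-- A (possibly infinite) row-stochastic matrix. -/
def IsStochastic (P : Matrix S S ℝ) : Prop :=
  (∀ x y, 0 ≤ P x y) ∧ ∀ x, HasSum (fun y => P x y) 1

/-- `y` can be reached from `x` in finitely many (possibly zero) steps of positive probability. -/
def Reaches (P : Matrix S S ℝ) : S → S → Prop :=
  Relation.ReflTransGen (fun x y => 0 < P x y)

/-- A final class: a nonempty closed communicating class. -/
def IsFinalClass (P : Matrix S S ℝ) (C : Set S) : Prop :=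
  C.Nonempty ∧ ∀ x ∈ C, ∀ y, Reaches P x y ↔ y ∈ C

/-- `firstPassage P n x y` is the probability that the chain started in `x` visits `y`,
at a time `≥ 1`, for the first time at time `n + 1`.
(For a stochastic matrix `P` all the sums converge.) -/
def firstPassage [DecidableEq S] (P : Matrix S S ℝ) : ℕ → S → S → ℝ
  | 0 => P
  | n + 1 => fun x y => ∑' z, if z = y then 0 else P x z * firstPassage P n z y

/-- The chain is recurrent: from every state the return to that state is almost sure. -/
def IsRecurrent [DecidableEq S] (P : Matrix S S ℝ) : Prop :=
  ∀ x, HasSum (fun n => firstPassage P n x x) 1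

/-- The Poisson equation `(I - P) u = g`. -/
def SolvesPoisson [DecidableEq S] {𝕜 : Type*} [RCLike 𝕜]
    (P : Matrix S S ℝ) (u g : S → 𝕜) : Prop :=
  ∀ x, HasSum (fun y => ((1 - P) x y) • u y) (g x)

end Chains

variable {m : ℕ}

/-! ### Finite matrices -/

/-- A stationary distribution of a finite matrix. -/
def IsStationaryDistribution (Q : Matrix (Fin m) (Fin m) ℝ) (p : Fin m → ℝ) : Prop :=
  (∀ i, 0 ≤ p i) ∧ p ᵥ* (1 - Q) = 0 ∧ ∑ i, p i = 1

/-- `D` is the group inverse of `H`. -/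
def IsGroupInverse (H D : Matrix (Fin m) (Fin m) ℝ) : Prop :=
  H * D = D * H ∧ H * D * H = H ∧ D * H * D = D

open Classical in
/-- The group inverse of `H` if it exists (it is then unique), and `0` otherwise. -/
def groupInverse (H : Matrix (Fin m) (Fin m) ℝ) : Matrix (Fin m) (Fin m) ℝ :=
  if h : ∃ D, IsGroupInverse H D then h.choose else 0

/-- The spectral radius of a real square matrix (largest modulus of a complex eigenvalue). -/
def specRadius (M : Matrix (Fin m) (Fin m) ℝ) : ℝ :=
  (spectralRadius ℂ (M.map (algebraMap ℝ ℂ))).toReal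

/-- `X` is the minimal (for the entrywise order) entrywise nonnegative solution of the matrix
equation `F X = 0`. -/
def IsMinimalNonnegSolution (F : Matrix (Fin m) (Fin m) ℝ → Matrix (Fin m) (Fin m) ℝ)
    (X : Matrix (Fin m) (Fin m) ℝ) : Prop :=
  (∀ i j, 0 ≤ X i j) ∧ F X = 0 ∧
    ∀ Y, (∀ i j, 0 ≤ Y i j) → F Y = 0 → ∀ i j, X i j ≤ Y i j

/-- A real matrix acting on a vector with real or complex entries. -/
def act {𝕜 : Type*} [RCLike 𝕜] (M : Matrix (Fin m) (Fin m) ℝ) (v : Fin m → 𝕜) : Fin m → 𝕜 :=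
  (M.map (algebraMap ℝ 𝕜)) *ᵥ v

/-! ### Quasi-birth-and-death processes

The blocks `Am`, `A0`, `Ap` stand for `A₋₁`, `A₀`, `A₁`. -/

/-- Transition matrix of the QBD process on the levels `0, 1, 2, …`. -/
def transition (B Am A0 Ap : Matrix (Fin m) (Fin m) ℝ) : Matrix (ℕ × Fin m) (ℕ × Fin m) ℝ :=
  fun x y =>
    if y.1 = x.1 + 1 then Ap x.2 y.2
    else if y.1 = x.1 then (if x.1 = 0 then B x.2 y.2 else A0 x.2 y.2)
    else if y.1 + 1 = x.1 then Am x.2 y.2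
    else 0

/-- Transition matrix of the doubly infinite QBD process, on the levels `…, -1, 0, 1, …`. -/
def doublyInfinite (Am A0 Ap : Matrix (Fin m) (Fin m) ℝ) : Matrix (ℤ × Fin m) (ℤ × Fin m) ℝ :=
  fun x y =>
    if y.1 = x.1 + 1 then Ap x.2 y.2
    else if y.1 = x.1 then A0 x.2 y.2
    else if y.1 + 1 = x.1 then Am x.2 y.2
    else 0

/-- The doubly infinite QBD has exactly one final class, it is of the form `ℤ × E` with `E`
nonempty, and every other state is on a path to that class. -/
def OneFinalClass (Am A0 Ap : Matrix (Fin m) (Fin m) ℝ) : Prop :=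
  ∃ E : Set (Fin m), E.Nonempty ∧
    (∀ C, IsFinalClass (doublyInfinite Am A0 Ap) C ↔ C = Set.univ ×ˢ E) ∧
    ∀ x, x ∉ (Set.univ : Set ℤ) ×ˢ E →
      ∃ y ∈ (Set.univ : Set ℤ) ×ˢ E, Reaches (doublyInfinite Am A0 Ap) x y

/-- `G` is the minimal nonnegative solution of `A₋₁ + (A₀ - I) X + A₁ X² = 0`. -/
def IsG (Am A0 Ap G : Matrix (Fin m) (Fin m) ℝ) : Prop :=
  IsMinimalNonnegSolution (fun X => Am + (A0 - 1) * X + Ap * X ^ 2) G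

/-- `R` is the minimal nonnegative solution of `A₁ + X (A₀ - I) + X² A₋₁ = 0`. -/
def IsR (Am A0 Ap R : Matrix (Fin m) (Fin m) ℝ) : Prop :=
  IsMinimalNonnegSolution (fun X => Ap + X * (A0 - 1) + X ^ 2 * Am) R

/-- `U = A₀ + R A₋₁`. -/
def matU (Am A0 R : Matrix (Fin m) (Fin m) ℝ) : Matrix (Fin m) (Fin m) ℝ := A0 + R * Am

/-- `P⁎ = B + A₁ G`. -/
def pStar (B Ap G : Matrix (Fin m) (Fin m) ℝ) : Matrix (Fin m) (Fin m) ℝ := B + Ap * G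

section Solution

variable {𝕜 : Type*} [RCLike 𝕜]

/-- `γ = (I - P⁎)^# ∑_{k ≥ 0} R^k g_k`. -/
def gammaVec (B Ap G R : Matrix (Fin m) (Fin m) ℝ) (g : ℕ → Fin m → 𝕜) : Fin m → 𝕜 :=
  act (groupInverse (1 - pStar B Ap G)) (∑' k, act (R ^ k) (g k))

/-- The `k`-th term `∑_{0 ≤ j < r} G^j (U - I)⁻¹ R^k g_{r+k-j}` of the series for `- y_r`. -/
def yTerm (Am A0 G R : Matrix (Fin m) (Fin m) ℝ) (g : ℕ → Fin m → 𝕜) (r k : ℕ) : Fin m → 𝕜 :=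
  ∑ j ∈ Finset.range r, act (G ^ j * (matU Am A0 R - 1)⁻¹ * R ^ k) (g (r + k - j))

/-- `y_r = - ∑_{k ≥ 0} ∑_{0 ≤ j < r} G^j (U - I)⁻¹ R^k g_{r+k-j}`. -/
def yVec (Am A0 G R : Matrix (Fin m) (Fin m) ℝ) (g : ℕ → Fin m → 𝕜) (r : ℕ) : Fin m → 𝕜 :=
  -∑' k, yTerm Am A0 G R g r k

/-- `ω_r = G^r γ + y_r + c 1`. -/
def omegaVec (B Am A0 Ap G R : Matrix (Fin m) (Fin m) ℝ) (g : ℕ → Fin m → 𝕜) (c : 𝕜) (r : ℕ) :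
    Fin m → 𝕜 :=
  act (G ^ r) (gammaVec B Ap G R g) + yVec Am A0 G R g r + fun _ => c

end Solution

end QBD

end

/-! Everything is reduced to one level by censoring. The matrix `V = A₀ + A₁G` (`taboo`) describes
returns to a level before it is left downwards. A set of phases closed under `V` with full row sums
would confine the doubly infinite chain to a half-line, but the final-class hypothesis makes that
chain connected. The minimum principle then makes `I - V` invertible with nonnegative inverse, and
minimality of `R` and `G` gives `U = V`, `R = A₁(I - V)⁻¹`, `G = (I - V)⁻¹A₋₁` (`matU_eq_and`).

Convergence needs `Rᵏ = O(ρ(R)ᵏ)` without polynomial factor. This holds because every index on a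
cycle of the graph of `R` leads to all indices (`exists_pow_le_specRadius_pow`, `R_cyclic_reaches`).

With `s_n = ∑ Rᵏ g_{n+k}` one has `s_n = g_n + R s_{n+1}` and `y_{r+1} = (I - V)⁻¹ s_{r+1} + G y_r`.
The rows above level 0 then hold for any `γ`, and level 0 asks only for `(I - P⁎)γ = s_0`. If `P⁎1 ≠
1`, then `I - P⁎` is invertible. If `P⁎1 = 1`, the QBD is recurrent (`isRecurrent_of_pStar`) and `(I
- P⁎)(I - P⁎)^# = I - 1π⁎ᵀ` fixes `s_0` by the orthogonality assumption. -/

namespace QBD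

/-! ### Nonnegative matrices and the minimum principle -/

section Nonneg

variable {ι : Type*}

/-- An irreducible matrix has no proper nonempty closed set of indices. -/
lemma mem_of_isIrreducible {A : Matrix ι ι ℝ} (h : A.IsIrreducible) {T : Set ι}
    (hT : ∀ x ∈ T, ∀ y, 0 < A x y → y ∈ T) {x : ι} (hx : x ∈ T) (y : ι) : y ∈ T := by
  let := A.toQuiver
  obtain ⟨p, -⟩ := h.connected x y
  clear h
  induction p with
  | nil => exact hx
  | cons q e ih => exact hT _ ih _ e.down

lemma mem_of_reaches {A : Matrix ι ι ℝ} {T : Set ι}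
    (hT : ∀ x ∈ T, ∀ y, 0 < A x y → y ∈ T) {x y : ι} (h : Reaches A x y) (hx : x ∈ T) :
    y ∈ T := by
  induction h with
  | refl => exact hx
  | tail _ e ih => exact hT _ ih _ e

variable [Fintype ι]

/-- The set of indices is left with positive probability from everywhere: there is no nonempty
closed set on which all row sums are `1`. -/
def NoTrap (Q : Matrix ι ι ℝ) : Prop :=
  ∀ S : Set ι, (∀ i ∈ S, ∀ j, 0 < Q i j → j ∈ S) → (∀ i ∈ S, ∑ j, Q i j = 1) → S = ∅

lemma mul_nonneg_apply {κ μ : Type*} {A : Matrix κ ι ℝ} {B : Matrix ι μ ℝ}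
    (hA : ∀ i j, 0 ≤ A i j) (hB : ∀ i j, 0 ≤ B i j) (i : κ) (j : μ) : 0 ≤ (A * B) i j :=
  Finset.sum_nonneg fun _ _ => mul_nonneg (hA _ _) (hB _ _)

lemma mul_le_mul_apply {A A' B B' : Matrix ι ι ℝ} (hB : ∀ i j, 0 ≤ B i j)
    (hA' : ∀ i j, 0 ≤ A' i j) (h : ∀ i j, A i j ≤ A' i j)
    (h' : ∀ i j, B i j ≤ B' i j) (i j : ι) : (A * B) i j ≤ (A' * B') i j :=
  Finset.sum_le_sum fun _ _ => mul_le_mul (h _ _) (h' _ _) (hB _ _) (hA' _ _)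

lemma mul_pos_apply {A B : Matrix ι ι ℝ} (hA : ∀ i j, 0 ≤ A i j) (hB : ∀ i j, 0 ≤ B i j)
    {i k j : ι} (h : 0 < A i k) (h' : 0 < B k j) : 0 < (A * B) i j :=
  Finset.sum_pos' (fun _ _ => mul_nonneg (hA _ _) (hB _ _)) ⟨k, Finset.mem_univ _, mul_pos h h'⟩

lemma exists_of_mul_pos {A B : Matrix ι ι ℝ} (hA : ∀ i j, 0 ≤ A i j) (hB : ∀ i j, 0 ≤ B i j)
    {i j : ι} (h : 0 < (A * B) i j) : ∃ k, 0 < A i k ∧ 0 < B k j := by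
  rw [Matrix.mul_apply] at h
  obtain ⟨k, -, hk⟩ := Finset.exists_lt_of_sum_lt (s := Finset.univ) (f := fun _ => (0 : ℝ))
    (g := fun k => A i k * B k j) (by simpa using h)
  refine ⟨k, (hA i k).lt_of_ne ?_, (hB k j).lt_of_ne ?_⟩ <;> intro h0 <;> simp [← h0] at hk

/-- Equality in the minimum principle at a minimal entry of a superharmonic vector. -/
lemma eq_of_mulVec_le_of_min {Q : Matrix ι ι ℝ} (hQ : ∀ i j, 0 ≤ Q i j)
    {x : ι → ℝ} {i : ι} (hx : ∀ j, x i ≤ x j) (h : (Q *ᵥ x) i ≤ x i)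
    (h1 : x i ≤ (∑ j, Q i j) * x i) : (∑ j, Q i j) * x i = x i ∧
      ∀ j, 0 < Q i j → x j = x i := by
  have hle : ∀ j ∈ Finset.univ, Q i j * x i ≤ Q i j * x j := fun j _ =>
    mul_le_mul_of_nonneg_left (hx j) (hQ i j)
  have hs : ∑ j, Q i j * x i ≤ ∑ j, Q i j * x j := Finset.sum_le_sum hle
  have h2 : ∑ j, Q i j * x j ≤ x i := h
  have h3 : ∑ j, Q i j * x i = (∑ j, Q i j) * x i := (Finset.sum_mul ..).symm
  refine ⟨by linarith, fun j hj => ?_⟩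
  have := (Finset.sum_eq_sum_iff_of_le hle).1 (by linarith) j (Finset.mem_univ _)
  exact (mul_left_cancel₀ hj.ne' this).symm

/-- At a negative minimum, row sums at most `1` force equality in the minimum principle, so the
indices attaining the minimum form a trap. -/
lemma nonneg_of_mulVec_le {Q : Matrix ι ι ℝ} (hQ : ∀ i j, 0 ≤ Q i j)
    (hQ1 : ∀ i, ∑ j, Q i j ≤ 1) (hT : NoTrap Q) {x : ι → ℝ} (hx : ∀ i, (Q *ᵥ x) i ≤ x i)
    (i : ι) : 0 ≤ x i := by
  by_contra! hi
  have : Nonempty ι := ⟨i⟩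
  obtain ⟨i₀, h₀⟩ := Finite.exists_min x
  have hneg : x i₀ < 0 := (h₀ i).trans_lt hi
  have key : ∀ k, x k = x i₀ → (∑ j, Q k j) * x k = x k ∧ ∀ j, 0 < Q k j → x j = x k :=
    fun k hk => eq_of_mulVec_le_of_min hQ (fun j => hk ▸ h₀ j) (hx k)
      (by nlinarith [hQ1 k])
  have := hT {k | x k = x i₀} (fun k hk j hj => ((key k hk).2 j hj).trans hk) (fun k hk => by
    have h := (key k hk).1
    have h0 : x k ≠ 0 := by rw [show x k = x i₀ from hk]; exact hneg.ne
    exact mul_right_cancel₀ h0 (by rw [h, one_mul]))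
  exact (this ▸ (rfl : i₀ ∈ {k | x k = x i₀}) : i₀ ∈ (∅ : Set ι))

lemma eq_zero_of_mulVec_eq {Q : Matrix ι ι ℝ} (hQ : ∀ i j, 0 ≤ Q i j)
    (hQ1 : ∀ i, ∑ j, Q i j ≤ 1) (hT : NoTrap Q) {x : ι → ℝ} (hx : Q *ᵥ x = x) : x = 0 := by
  ext i
  refine le_antisymm ?_ (nonneg_of_mulVec_le hQ hQ1 hT (fun i => (congrFun hx i).le) i)
  have := nonneg_of_mulVec_le hQ hQ1 hT (x := -x)
    (fun i => by rw [Matrix.mulVec_neg, hx]) i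
  simpa using this

variable [DecidableEq ι]

lemma isUnit_one_sub {Q : Matrix ι ι ℝ} (hQ : ∀ i j, 0 ≤ Q i j)
    (hQ1 : ∀ i, ∑ j, Q i j ≤ 1) (hT : NoTrap Q) : IsUnit (1 - Q) := by
  rw [← Matrix.mulVec_injective_iff_isUnit, ← Matrix.coe_mulVecLin,
    injective_iff_map_eq_zero]
  intro x hx
  refine eq_zero_of_mulVec_eq hQ hQ1 hT ?_
  rw [Matrix.mulVecLin_apply, Matrix.sub_mulVec, Matrix.one_mulVec, sub_eq_zero] at hx
  exact hx.symm

/-- Each column `x` of the inverse satisfies `x = Qx + e_j ≥ Qx`, so the minimum principle applies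
to it. -/
lemma inv_one_sub_nonneg {Q : Matrix ι ι ℝ} (hQ : ∀ i j, 0 ≤ Q i j)
    (hQ1 : ∀ i, ∑ j, Q i j ≤ 1) (hT : NoTrap Q) (i j : ι) : 0 ≤ ((1 - Q)⁻¹) i j := by
  have hu := (Matrix.isUnit_iff_isUnit_det _).1 (isUnit_one_sub hQ hQ1 hT)
  refine nonneg_of_mulVec_le hQ hQ1 hT (x := fun k => ((1 - Q)⁻¹) k j) (fun k => ?_) i
  have h := congrFun (congrFun (Matrix.mul_nonsing_inv _ hu) k) j
  rw [Matrix.sub_mul, Matrix.one_mul, Matrix.sub_apply, Matrix.mul_apply] at h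
  have h1 : (0 : ℝ) ≤ (1 : Matrix ι ι ℝ) k j := by
    rw [Matrix.one_apply]; split_ifs <;> norm_num
  change ∑ l, Q k l * ((1 - Q)⁻¹) l j ≤ _
  linarith

end Nonneg

/-! ### The matrices `G`, `R` and `U` -/

section Blocks

variable {m : ℕ} {Am A0 Ap G R : Matrix (Fin m) (Fin m) ℝ}

/-- The blocks are nonnegative and their sum is row-stochastic. -/
structure StochasticBlocks (Am A0 Ap : Matrix (Fin m) (Fin m) ℝ) : Prop where
  down_nonneg : ∀ i j, 0 ≤ Am i j
  same_nonneg : ∀ i j, 0 ≤ A0 i j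
  up_nonneg : ∀ i j, 0 ≤ Ap i j
  row_sum : Am *ᵥ 1 + A0 *ᵥ 1 + Ap *ᵥ 1 = 1

lemma isG_eq (hG : IsG Am A0 Ap G) : G = Am + A0 * G + Ap * G * G := by
  have h : Am + (A0 - 1) * G + Ap * G ^ 2 = 0 := hG.2.1
  rw [sub_mul, one_mul, pow_two, ← mul_assoc] at h
  rw [← sub_eq_zero, ← neg_eq_zero, ← h]; abel

lemma isR_eq (hR : IsR Am A0 Ap R) : R = Ap + R * A0 + R * R * Am := by
  have h : Ap + R * (A0 - 1) + R ^ 2 * Am = 0 := hR.2.1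
  rw [mul_sub, mul_one, pow_two] at h
  rw [← sub_eq_zero, ← neg_eq_zero, ← h]; abel

lemma isG_le (hG : IsG Am A0 Ap G) {Y : Matrix (Fin m) (Fin m) ℝ} (hY : ∀ i j, 0 ≤ Y i j)
    (h : Y = Am + A0 * Y + Ap * Y * Y) (i j : Fin m) : G i j ≤ Y i j := by
  refine hG.2.2 Y hY ?_ i j
  change Am + (A0 - 1) * Y + Ap * Y ^ 2 = 0
  rw [sub_mul, one_mul, pow_two, ← mul_assoc]
  nth_rw 2 [h]; abel

lemma isR_le (hR : IsR Am A0 Ap R) {Y : Matrix (Fin m) (Fin m) ℝ} (hY : ∀ i j, 0 ≤ Y i j)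
    (h : Y = Ap + Y * A0 + Y * Y * Am) (i j : Fin m) : R i j ≤ Y i j := by
  refine hR.2.2 Y hY ?_ i j
  change Ap + Y * (A0 - 1) + Y ^ 2 * Am = 0
  rw [mul_sub, mul_one, pow_two]
  nth_rw 2 [h]; abel

/-- Functional iteration for `G`, started at `0`. -/
def gIter (Am A0 Ap : Matrix (Fin m) (Fin m) ℝ) : ℕ → Matrix (Fin m) (Fin m) ℝ
  | 0 => 0
  | n + 1 => Am + A0 * gIter Am A0 Ap n + Ap * gIter Am A0 Ap n * gIter Am A0 Ap n

lemma gIter_nonneg (h : StochasticBlocks Am A0 Ap) (n : ℕ) (i j : Fin m) :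
    0 ≤ gIter Am A0 Ap n i j := by
  induction n generalizing i j with
  | zero => simp [gIter]
  | succ n ih =>
    have h1 := mul_nonneg_apply h.same_nonneg ih i j
    have h2 := mul_nonneg_apply (mul_nonneg_apply h.up_nonneg ih) ih i j
    have h3 := h.down_nonneg i j
    simp only [gIter, Matrix.add_apply]
    linarith

lemma gStep_mono (h : StochasticBlocks Am A0 Ap) {X Y : Matrix (Fin m) (Fin m) ℝ}
    (hX : ∀ i j, 0 ≤ X i j) (hXY : ∀ i j, X i j ≤ Y i j) (i j : Fin m) :
    (Am + A0 * X + Ap * X * X) i j ≤ (Am + A0 * Y + Ap * Y * Y) i j := by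
  have hY : ∀ i j, 0 ≤ Y i j := fun i j => (hX i j).trans (hXY i j)
  have h1 := mul_le_mul_apply hX h.same_nonneg (fun i j => le_refl _) hXY i j
  have h2 := mul_le_mul_apply hX (mul_nonneg_apply h.up_nonneg hY)
    (mul_le_mul_apply hX h.up_nonneg (fun i j => le_refl _) hXY) hXY i j
  simp only [Matrix.add_apply]
  linarith

lemma gIter_mono (h : StochasticBlocks Am A0 Ap) (i j : Fin m) :
    Monotone fun n => gIter Am A0 Ap n i j := by
  refine monotone_nat_of_le_succ fun n => ?_
  induction n generalizing i j with
  | zero => exact gIter_nonneg h 1 i j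
  | succ n ih => exact gStep_mono h (gIter_nonneg h n) ih i j

lemma gIter_le (h : StochasticBlocks Am A0 Ap) (hG : IsG Am A0 Ap G) (n : ℕ) (i j : Fin m) :
    gIter Am A0 Ap n i j ≤ G i j := by
  induction n generalizing i j with
  | zero => exact hG.1 i j
  | succ n ih =>
    rw [isG_eq hG]
    exact gStep_mono h (gIter_nonneg h n) ih i j

open Filter Topology in
/-- The functional iteration converges to `G`. -/
lemma tendsto_gIter (h : StochasticBlocks Am A0 Ap) (hG : IsG Am A0 Ap G) :
    Tendsto (gIter Am A0 Ap) atTop (𝓝 G) := by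
  have hlim : ∀ i j, ∃ l, Tendsto (fun n => gIter Am A0 Ap n i j) atTop (𝓝 l) := fun i j =>
    ⟨_, tendsto_atTop_ciSup (gIter_mono h i j) ⟨G i j, by rintro _ ⟨n, rfl⟩; exact gIter_le h hG n i j⟩⟩
  choose L' hL using hlim
  obtain ⟨L, rfl⟩ : ∃ L : Matrix (Fin m) (Fin m) ℝ, L = L' := ⟨L', rfl⟩
  have hLt : Tendsto (gIter Am A0 Ap) atTop (𝓝 L) :=
    tendsto_pi_nhds.2 fun i => tendsto_pi_nhds.2 fun j => hL i j
  have hL0 : ∀ i j, 0 ≤ L i j := fun i j =>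
    ge_of_tendsto' (hL i j) fun n => gIter_nonneg h n i j
  have hc : Continuous fun X : Matrix (Fin m) (Fin m) ℝ => Am + A0 * X + Ap * X * X := by fun_prop
  have heq : L = Am + A0 * L + Ap * L * L :=
    tendsto_nhds_unique (hLt.comp (tendsto_add_atTop_nat 1))
      ((hc.tendsto L).comp hLt)
  have : G = L := by
    ext i j
    exact le_antisymm (isG_le hG hL0 heq i j)
      (le_of_tendsto' (hL i j) fun n => gIter_le h hG n i j)
  rw [this]; exact hLt

open Filter Topology in
lemma G_mulVec_le_of_iter (h : StochasticBlocks Am A0 Ap) (hG : IsG Am A0 Ap G)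
    {x y : Fin m → ℝ} (hxy : ∀ n i, (gIter Am A0 Ap n *ᵥ x) i ≤ y i) (i : Fin m) :
    (G *ᵥ x) i ≤ y i := by
  have hc : Continuous fun X : Matrix (Fin m) (Fin m) ℝ => (X *ᵥ x) i := by
    unfold Matrix.mulVec dotProduct; fun_prop
  exact le_of_tendsto' ((hc.tendsto G).comp (tendsto_gIter h hG)) fun n => hxy n i

lemma mulVec_mono {A : Matrix (Fin m) (Fin m) ℝ} (hA : ∀ i j, 0 ≤ A i j) {x y : Fin m → ℝ}
    (hxy : ∀ i, x i ≤ y i) (i : Fin m) : (A *ᵥ x) i ≤ (A *ᵥ y) i := by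
  simp only [Matrix.mulVec, dotProduct]
  exact Finset.sum_le_sum fun j _ => mul_le_mul_of_nonneg_left (hxy j) (hA i j)

/-- A nonnegative function which is superharmonic above level `0` dominates the action of `G`. -/
lemma G_mulVec_le_of_superharmonic (h : StochasticBlocks Am A0 Ap) (hG : IsG Am A0 Ap G)
    {s : ℕ → Fin m → ℝ} (hs0 : ∀ n i, 0 ≤ s n i)
    (hs : ∀ n i, (Am *ᵥ s n + A0 *ᵥ s (n + 1) + Ap *ᵥ s (n + 2)) i ≤ s (n + 1) i)
    (n : ℕ) (i : Fin m) : (G *ᵥ s n) i ≤ s (n + 1) i := by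
  refine G_mulVec_le_of_iter h hG (fun k => ?_) i
  -- All levels are treated at once: the term `A₁XX s_n` uses the bound at levels `n` and `n + 1`.
  induction k generalizing n with
  | zero => intro i; simpa [gIter] using hs0 _ i
  | succ k ih =>
    intro i
    refine le_trans ?_ (hs n i)
    have hX := gIter_nonneg h k
    have h1 := mulVec_mono h.same_nonneg (ih n) i
    have h2 := mulVec_mono h.up_nonneg (fun i => (mulVec_mono hX (ih n) i).trans (ih (n + 1) i)) i
    simp only [gIter, Matrix.add_mulVec, Pi.add_apply, ← Matrix.mulVec_mulVec]
    linarith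

lemma G_mulVec_one_le (h : StochasticBlocks Am A0 Ap) (hG : IsG Am A0 Ap G) (i : Fin m) :
    (G *ᵥ 1) i ≤ 1 :=
  G_mulVec_le_of_superharmonic h hG (s := fun _ => 1) (fun _ _ => zero_le_one)
    (fun _ i => (congrFun h.row_sum i).le) 0 i

/-- The doubly infinite chain can move between any two states. -/
def Connected (Am A0 Ap : Matrix (Fin m) (Fin m) ℝ) : Prop :=
  ∀ x y, Reaches (doublyInfinite Am A0 Ap) x y

lemma reaches_of_sum_pos (h : StochasticBlocks Am A0 Ap) (n : ℤ) {i j : Fin m}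
    (hij : 0 < (Am + A0 + Ap) i j) : ∃ k, Reaches (doublyInfinite Am A0 Ap) (n, i) (k, j) := by
  simp only [Matrix.add_apply] at hij
  rcases (h.down_nonneg i j).lt_or_eq with h1 | h1
  · refine ⟨n - 1, .single ?_⟩
    simp [doublyInfinite, h1, show ¬ n - 1 = n + 1 by omega]
  rcases (h.same_nonneg i j).lt_or_eq with h2 | h2
  · exact ⟨n, .single (by simp [doublyInfinite, h2])⟩
  · exact ⟨n + 1, .single (by simp [doublyInfinite]; linarith)⟩

/-- The phases of the final class are closed under `A₋₁ + A₀ + A₁`, hence are all phases by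
irreducibility; the final class is then the whole state space. -/
lemma connected_of_oneFinalClass (h : StochasticBlocks Am A0 Ap)
    (hA : (Am + A0 + Ap).IsIrreducible) (hf : OneFinalClass Am A0 Ap) : Connected Am A0 Ap := by
  obtain ⟨E, ⟨e, he⟩, hE, -⟩ := hf
  have hfin := (hE _).2 rfl
  have hE' : ∀ i ∈ E, ∀ j, 0 < (Am + A0 + Ap) i j → j ∈ E := fun i hi j hij => by
    obtain ⟨k, hk⟩ := reaches_of_sum_pos h 0 hij
    exact ((hfin.2 (0, i) ⟨trivial, hi⟩ _).1 hk).2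
  have hall := fun j => mem_of_isIrreducible hA hE' he j
  exact fun x y => (hfin.2 x ⟨trivial, hall _⟩ y).2 ⟨trivial, hall _⟩

end Blocks

/-! ### Descents through powers of `G`, and the censored matrices -/

section Blocks

variable {m : ℕ} {B Am A0 Ap G R : Matrix (Fin m) (Fin m) ℝ}

lemma pow_nonneg_apply {A : Matrix (Fin m) (Fin m) ℝ} (hA : ∀ i j, 0 ≤ A i j) (n : ℕ)
    (i j : Fin m) : 0 ≤ (A ^ n) i j := by
  induction n generalizing i j with
  | zero => rw [pow_zero, Matrix.one_apply]; split_ifs <;> norm_num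
  | succ n ih => rw [pow_succ]; exact mul_nonneg_apply ih hA i j

lemma G_pow_succ (hG : IsG Am A0 Ap G) (n : ℕ) :
    G ^ (n + 1) = Am * G ^ n + A0 * G ^ (n + 1) + Ap * G ^ (n + 2) := by
  calc G ^ (n + 1) = G * G ^ n := pow_succ' G n
    _ = (Am + A0 * G + Ap * G * G) * G ^ n := by rw [← isG_eq hG]
    _ = _ := by rw [pow_succ' G (n + 1), pow_succ' G n]; noncomm_ring

/-- The states from which the descent of `n` levels ends in the set `S` of phases. -/
def DescendsTo (G : Matrix (Fin m) (Fin m) ℝ) (S : Set (Fin m)) (n : ℕ) (j : Fin m) : Prop :=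
  ∀ k, 0 < (G ^ n) j k → k ∈ S

lemma descendsTo_zero {S : Set (Fin m)} {j : Fin m} : DescendsTo G S 0 j ↔ j ∈ S := by
  constructor
  · intro h; exact h j (by simp)
  · intro h k hk
    rw [pow_zero, Matrix.one_apply] at hk
    split_ifs at hk with e
    · exact e ▸ h
    · exact absurd hk (lt_irrefl _)

lemma descendsTo_of_mul {A : Matrix (Fin m) (Fin m) ℝ} (hA : ∀ i j, 0 ≤ A i j)
    (hG : ∀ i j, 0 ≤ G i j) {S : Set (Fin m)} {n : ℕ} {j l : Fin m} (hl : 0 < A j l)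
    (h : ∀ k, 0 < (A * G ^ n) j k → k ∈ S) : DescendsTo G S n l :=
  fun k hk => h k (mul_pos_apply hA (pow_nonneg_apply hG n) hl hk)

/-- All terms of `G_pow_succ` are nonnegative, so a positive entry of one of them is a positive
entry of `G ^ (n + 1)`. The exponent follows the level of the chain. -/
lemma descendsTo_step (h : StochasticBlocks Am A0 Ap) (hG : IsG Am A0 Ap G) {S : Set (Fin m)}
    {n : ℕ} {j l : Fin m} (hj : DescendsTo G S (n + 1) j) :
    (0 < Am j l → DescendsTo G S n l) ∧ (0 < A0 j l → DescendsTo G S (n + 1) l) ∧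
      (0 < Ap j l → DescendsTo G S (n + 2) l) := by
  have hp := pow_nonneg_apply hG.1
  have h1 := mul_nonneg_apply h.down_nonneg (hp n)
  have h2 := mul_nonneg_apply h.same_nonneg (hp (n + 1))
  have h3 := mul_nonneg_apply h.up_nonneg (hp (n + 2))
  have key : ∀ k, (0 < (Am * G ^ n) j k ∨ 0 < (A0 * G ^ (n + 1)) j k ∨
      0 < (Ap * G ^ (n + 2)) j k) → k ∈ S := fun k hk => hj k (by
    rw [G_pow_succ hG, Matrix.add_apply, Matrix.add_apply]
    have := h1 j k; have := h2 j k; have := h3 j k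
    rcases hk with hk | hk | hk <;> linarith)
  exact ⟨fun hl => descendsTo_of_mul h.down_nonneg hG.1 hl fun k hk => key k (.inl hk),
    fun hl => descendsTo_of_mul h.same_nonneg hG.1 hl fun k hk => key k (.inr (.inl hk)),
    fun hl => descendsTo_of_mul h.up_nonneg hG.1 hl fun k hk => key k (.inr (.inr hk))⟩

lemma doublyInfinite_pos {x y : ℤ × Fin m} (h : 0 < doublyInfinite Am A0 Ap x y) :
    (y.1 = x.1 + 1 ∧ 0 < Ap x.2 y.2) ∨ (y.1 = x.1 ∧ 0 < A0 x.2 y.2) ∨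
      (y.1 + 1 = x.1 ∧ 0 < Am x.2 y.2) := by
  unfold doublyInfinite at h
  split_ifs at h with h1 h2 h3
  · exact .inl ⟨h1, h⟩
  · exact .inr (.inl ⟨h2, h⟩)
  · exact .inr (.inr ⟨h3, h⟩)
  · exact absurd h (lt_irrefl _)

lemma transition_pos {x y : ℕ × Fin m} (h : 0 < transition B Am A0 Ap x y) :
    (y.1 = x.1 + 1 ∧ 0 < Ap x.2 y.2) ∨ (y.1 = x.1 ∧ x.1 = 0 ∧ 0 < B x.2 y.2) ∨
      (y.1 = x.1 ∧ x.1 ≠ 0 ∧ 0 < A0 x.2 y.2) ∨ (y.1 + 1 = x.1 ∧ 0 < Am x.2 y.2) := by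
  unfold transition at h
  split_ifs at h with h1 h2 h3 h4
  · exact .inl ⟨h1, h⟩
  · exact .inr (.inl ⟨h2, h3, h⟩)
  · exact .inr (.inr (.inl ⟨h2, h3, h⟩))
  · exact .inr (.inr (.inr ⟨h4, h⟩))
  · exact absurd h (lt_irrefl _)

/-- The censored matrix `A₀ + A₁ G` on a level, killed at the level below. -/
def taboo (A0 Ap G : Matrix (Fin m) (Fin m) ℝ) : Matrix (Fin m) (Fin m) ℝ := A0 + Ap * G

lemma taboo_nonneg (h : StochasticBlocks Am A0 Ap) (hG : IsG Am A0 Ap G) (i j : Fin m) :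
    0 ≤ taboo A0 Ap G i j :=
  add_nonneg (h.same_nonneg i j) (mul_nonneg_apply h.up_nonneg hG.1 i j)

lemma mulVec_one_apply (A : Matrix (Fin m) (Fin m) ℝ) (i : Fin m) : (A *ᵥ 1) i = ∑ j, A i j := by
  simp [Matrix.mulVec, dotProduct]

lemma up_G_row_sum_le (h : StochasticBlocks Am A0 Ap) (hG : IsG Am A0 Ap G) (i : Fin m) :
    ((Ap * G) *ᵥ 1) i ≤ (Ap *ᵥ 1) i := by
  rw [← Matrix.mulVec_mulVec]
  exact mulVec_mono h.up_nonneg (G_mulVec_one_le h hG) i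

lemma taboo_row_sum (h : StochasticBlocks Am A0 Ap) (hG : IsG Am A0 Ap G) (i : Fin m) :
    ∑ j, taboo A0 Ap G i j + ∑ j, Am i j ≤ 1 := by
  have h1 := up_G_row_sum_le h hG i
  have h2 := congrFun h.row_sum i
  simp only [Pi.add_apply, Pi.one_apply] at h2
  have h3 : ∑ j, taboo A0 Ap G i j = (A0 *ᵥ 1) i + ((Ap * G) *ᵥ 1) i := by
    rw [← mulVec_one_apply, taboo, Matrix.add_mulVec, Pi.add_apply]
  rw [h3, ← mulVec_one_apply Am]
  linarith

lemma taboo_row_sum_le_one (h : StochasticBlocks Am A0 Ap) (hG : IsG Am A0 Ap G) (i : Fin m) :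
    ∑ j, taboo A0 Ap G i j ≤ 1 := by
  have := taboo_row_sum h hG i
  have : 0 ≤ ∑ j, Am i j := Finset.sum_nonneg fun j _ => h.down_nonneg i j
  linarith

/-- Full row sums of `V` on a trap `S` leave no mass for `A₋₁` there. The states at levels at least
`1` whose descent to level `1` ends in `S` are then closed for the doubly infinite chain,
contradicting connectedness. -/
lemma taboo_noTrap (h : StochasticBlocks Am A0 Ap) (hc : Connected Am A0 Ap)
    (hG : IsG Am A0 Ap G) : NoTrap (taboo A0 Ap G) := by
  intro S hS hS1
  by_contra hne
  obtain ⟨i, hi⟩ := Set.nonempty_iff_ne_empty.2 hne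
  have hAm : ∀ i ∈ S, ∀ j, ¬ 0 < Am i j := fun i hi j hj => by
    have h1 := taboo_row_sum h hG i
    have : 0 < ∑ j, Am i j :=
      Finset.sum_pos' (fun j _ => h.down_nonneg i j) ⟨j, Finset.mem_univ _, hj⟩
    linarith [hS1 i hi]
  have hT := mem_of_reaches (A := doublyInfinite Am A0 Ap)
    (T := {x | ∃ n : ℕ, x.1 = n + 1 ∧ DescendsTo G S n x.2}) ?_ (hc (1, i) (0, i))
    ⟨0, by simp, descendsTo_zero.2 hi⟩
  · obtain ⟨n, hn, -⟩ := hT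
    simp only at hn
    omega
  rintro ⟨_, j⟩ ⟨n, rfl, hj⟩ ⟨k, l⟩ hpos
  simp only at hj
  rcases doublyInfinite_pos hpos with ⟨hk, hl⟩ | ⟨hk, hl⟩ | ⟨hk, hl⟩ <;> simp only at hk hl
  · refine ⟨n + 1, by simp [hk], ?_⟩
    cases n with
    | zero =>
      -- One step up followed by a descent is an entry of `A₁G`, which is part of `V`.
      refine descendsTo_of_mul h.up_nonneg hG.1 hl fun k hk => hS j (descendsTo_zero.1 hj) k ?_
      rw [zero_add, pow_one] at hk
      exact add_pos_of_nonneg_of_pos (h.same_nonneg j k) hk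
    | succ n => exact (descendsTo_step h hG hj).2.2 hl
  · refine ⟨n, hk, ?_⟩
    cases n with
    | zero =>
      refine descendsTo_zero.2 (hS j (descendsTo_zero.1 hj) l ?_)
      exact add_pos_of_pos_of_nonneg hl (mul_nonneg_apply h.up_nonneg hG.1 j l)
    | succ n => exact (descendsTo_step h hG hj).2.1 hl
  · cases n with
    | zero => exact absurd hl (hAm j (descendsTo_zero.1 hj) l)
    | succ n => exact ⟨n, by push_cast at hk; simp only; omega, (descendsTo_step h hG hj).1 hl⟩

/-- The censored matrix on level `0` has no proper nonempty closed set. -/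
lemma pStar_closed (h : StochasticBlocks Am A0 Ap) (hB : ∀ i j, 0 ≤ B i j)
    (hirr : (transition B Am A0 Ap).IsIrreducible) (hG : IsG Am A0 Ap G) {S : Set (Fin m)}
    (hS : ∀ i ∈ S, ∀ j, 0 < pStar B Ap G i j → j ∈ S) {i : Fin m} (hi : i ∈ S) (j : Fin m) :
    j ∈ S := by
  -- The states whose descent to level `0` ends in `S` are closed for `P`; the boundary block `B`
  -- now governs level `0`.
  have hT := mem_of_isIrreducible hirr (T := {x | DescendsTo G S x.1 x.2}) ?_
    (x := (0, i)) (descendsTo_zero.2 hi) (0, j)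
  · exact descendsTo_zero.1 hT
  rintro ⟨n, j⟩ hj ⟨k, l⟩ hpos
  change DescendsTo G S n j at hj
  change DescendsTo G S k l
  rcases transition_pos hpos with ⟨hk, hl⟩ | ⟨hk, hn, hl⟩ | ⟨hk, hn, hl⟩ | ⟨hk, hl⟩ <;>
    simp only at hk hl
  · subst hk
    cases n with
    | zero =>
      refine descendsTo_of_mul h.up_nonneg hG.1 hl fun k hk => hS j (descendsTo_zero.1 hj) k ?_
      rw [zero_add, pow_one] at hk
      exact add_pos_of_nonneg_of_pos (hB j k) hk
    | succ n => exact (descendsTo_step h hG hj).2.2 hl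
  · simp only at hn
    subst hk hn
    refine descendsTo_zero.2 (hS j (descendsTo_zero.1 hj) l ?_)
    exact add_pos_of_pos_of_nonneg hl (mul_nonneg_apply h.up_nonneg hG.1 j l)
  · subst hk
    obtain ⟨n, rfl⟩ := Nat.exists_eq_succ_of_ne_zero hn
    exact (descendsTo_step h hG hj).2.1 hl
  · subst hk
    exact (descendsTo_step h hG hj).1 hl

/-- The relations between `G`, `R` and `U`. -/
lemma matU_eq_and (h : StochasticBlocks Am A0 Ap) (hc : Connected Am A0 Ap)
    (hG : IsG Am A0 Ap G) (hR : IsR Am A0 Ap R) :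
    matU Am A0 R = taboo A0 Ap G ∧ IsUnit (1 - taboo A0 Ap G) ∧
      R = Ap * (1 - taboo A0 Ap G)⁻¹ ∧ G = (1 - taboo A0 Ap G)⁻¹ * Am := by
  have hV0 := taboo_nonneg h hG
  have hV1 := taboo_row_sum_le_one h hG
  have hVT := taboo_noTrap h hc hG
  have hVu := isUnit_one_sub hV0 hV1 hVT
  have hVi := inv_one_sub_nonneg hV0 hV1 hVT
  have hVd := (Matrix.isUnit_iff_isUnit_det _).1 hVu
  set V := taboo A0 Ap G with hV
  have hGN : G = (1 - V)⁻¹ * Am := by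
    have : (1 - V) * G = Am := by
      rw [hV, taboo, sub_mul, one_mul, add_mul, sub_eq_iff_eq_add]
      nth_rw 1 [isG_eq hG]; abel
    rw [← this, Matrix.nonsing_inv_mul_cancel_left _ _ hVd]
  -- `A₁ (1 - V)⁻¹` solves the equation of `R`
  have hR'0 := mul_nonneg_apply h.up_nonneg hVi
  have hVR' : V = A0 + Ap * (1 - V)⁻¹ * Am := by
    rw [mul_assoc, ← hGN, hV, taboo]
  have hRle : ∀ i j, R i j ≤ (Ap * (1 - V)⁻¹) i j := by
    refine isR_le hR hR'0 ?_
    have h1 : Ap * (1 - V)⁻¹ * (1 - V) = Ap := Matrix.nonsing_inv_mul_cancel_right _ _ hVd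
    rw [mul_sub, mul_one, sub_eq_iff_eq_add] at h1
    rw [mul_assoc (Ap * (1 - V)⁻¹) (Ap * (1 - V)⁻¹) Am, add_assoc, ← mul_add, ← hVR', ← h1]
  have hUnn : ∀ i j, 0 ≤ matU Am A0 R i j := fun i j =>
    add_nonneg (h.same_nonneg i j) (mul_nonneg_apply hR.1 h.down_nonneg i j)
  have hUV : ∀ i j, matU Am A0 R i j ≤ V i j := fun i j => by
    rw [hVR']
    exact add_le_add le_rfl
      (mul_le_mul_apply h.down_nonneg hR'0 hRle (fun _ _ => le_rfl) i j)
  have hU1 : ∀ i, ∑ j, matU Am A0 R i j ≤ 1 := fun i =>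
    (Finset.sum_le_sum fun j _ => hUV i j).trans (hV1 i)
  -- On a trap of `U` the inequality of row sums is an equality, so `U = V` on those rows and the
  -- trap is one of `V`.
  have hUT : NoTrap (matU Am A0 R) := by
    intro S hS hS1
    have heq : ∀ i ∈ S, ∀ j, matU Am A0 R i j = V i j := fun i hi j =>
      (Finset.sum_eq_sum_iff_of_le fun j _ => hUV i j).1
        (le_antisymm (Finset.sum_le_sum fun j _ => hUV i j) (by rw [hS1 i hi]; exact hV1 i)) j
        (Finset.mem_univ j)
    refine hVT S (fun i hi j hj => hS i hi j (by rwa [heq i hi])) fun i hi => ?_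
    rw [← hS1 i hi]
    exact Finset.sum_congr rfl fun j _ => (heq i hi j).symm
  have hUd := (Matrix.isUnit_iff_isUnit_det _).1 (isUnit_one_sub hUnn hU1 hUT)
  have hUi := inv_one_sub_nonneg hUnn hU1 hUT
  set U := matU Am A0 R with hU
  have hRN : R = Ap * (1 - U)⁻¹ := by
    have : R * (1 - U) = Ap := by
      rw [hU, matU, mul_sub, mul_one, mul_add, sub_eq_iff_eq_add, ← mul_assoc]
      nth_rw 1 [isR_eq hR]; abel
    rw [← this, Matrix.mul_nonsing_inv_cancel_right _ _ hUd]
  -- The dual argument: `(1 - U)⁻¹ A₋₁` solves the equation of `G`, and minimality of `G` gives `V ≤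
  -- U`.
  have hG'0 := mul_nonneg_apply hUi h.down_nonneg
  have hUG' : U = A0 + Ap * ((1 - U)⁻¹ * Am) := by
    rw [← mul_assoc, ← hRN, hU, matU]
  have hGle : ∀ i j, G i j ≤ ((1 - U)⁻¹ * Am) i j := by
    refine isG_le hG hG'0 ?_
    have h1 : (1 - U) * ((1 - U)⁻¹ * Am) = Am := Matrix.mul_nonsing_inv_cancel_left _ _ hUd
    rw [sub_mul, one_mul, sub_eq_iff_eq_add] at h1
    rw [add_assoc, ← add_mul, ← hUG', ← h1]
  have hVU : ∀ i j, V i j ≤ U i j := fun i j => by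
    rw [hUG']
    exact add_le_add le_rfl
      (mul_le_mul_apply hG.1 h.up_nonneg (fun _ _ => le_rfl) hGle i j)
  have hUV' : U = V := by ext i j; exact le_antisymm (hUV i j) (hVU i j)
  exact ⟨hUV', hVu, hUV' ▸ hRN, hGN⟩

end Blocks

/-! ### Growth of the powers of a nonnegative matrix -/

section PowerGrowth

variable {m : ℕ} {A : Matrix (Fin m) (Fin m) ℝ}

open Filter Topology in
-- This is Gelfand's formula, with `b n` the norm of the complexified power induced by the sup norm.
lemma tendsto_norm_entry_bound (A : Matrix (Fin m) (Fin m) ℝ) :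
    ∃ b : ℕ → ℝ, (∀ n i j, |(A ^ n) i j| ≤ b n) ∧
      Tendsto (fun n : ℕ => b n ^ (1 / n : ℝ)) atTop (𝓝 (specRadius A)) := by
  let : NormedRing (Matrix (Fin m) (Fin m) ℂ) := Matrix.linftyOpNormedRing
  let : NormedAlgebra ℂ (Matrix (Fin m) (Fin m) ℂ) := Matrix.linftyOpNormedAlgebra
  have : CompleteSpace (Matrix (Fin m) (Fin m) ℂ) := FiniteDimensional.complete ℂ _
  set A' : Matrix (Fin m) (Fin m) ℂ := A.map (algebraMap ℝ ℂ) with hA'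
  refine ⟨fun n => ‖A' ^ n‖, fun n i j => ?_, ?_⟩
  · have h1 : A' ^ n = (A ^ n).map (algebraMap ℝ ℂ) :=
      (map_pow (algebraMap ℝ ℂ).mapMatrix A n).symm
    have h2 : |(A ^ n) i j| = ‖(A' ^ n) i j‖ := by
      rw [h1, Matrix.map_apply, Complex.coe_algebraMap, Complex.norm_real, Real.norm_eq_abs]
    rw [h2]
    refine NNReal.coe_le_coe.2 (?_ : ‖(A' ^ n) i j‖₊ ≤ ‖A' ^ n‖₊)
    rw [Matrix.linfty_opNNNorm_def]
    exact (Finset.single_le_sum (f := fun j => ‖(A' ^ n) i j‖₊) (fun _ _ => zero_le)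
      (Finset.mem_univ j)).trans
      (Finset.le_sup (f := fun i => ∑ j, ‖(A' ^ n) i j‖₊) (Finset.mem_univ i))
  · have hfin : spectralRadius ℂ A' ≠ ⊤ := by
      refine ne_top_of_le_ne_top (ENNReal.mul_ne_top (ENNReal.coe_ne_top (r := ‖A'‖₊))
        (ENNReal.coe_ne_top (r := ‖(1 : Matrix (Fin m) (Fin m) ℂ)‖₊))) ?_
      have := spectrum.spectralRadius_le_pow_nnnorm_pow_one_div ℂ A' 0
      simpa using this
    have h := (ENNReal.tendsto_toReal hfin).comp
      (spectrum.pow_norm_pow_one_div_tendsto_nhds_spectralRadius A')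
    refine h.congr fun n => ?_
    exact ENNReal.toReal_ofReal (Real.rpow_nonneg (norm_nonneg _) _)

lemma specRadius_nonneg (A : Matrix (Fin m) (Fin m) ℝ) : 0 ≤ specRadius A :=
  ENNReal.toReal_nonneg

lemma diag_pow_le (hA : ∀ i j, 0 ≤ A i j) (i : Fin m) (n : ℕ) :
    ((A i i) ^ n) ≤ (A ^ n) i i := by
  induction n with
  | zero => simp
  | succ n ih =>
    rw [pow_succ, pow_succ, Matrix.mul_apply]
    exact (mul_le_mul_of_nonneg_right ih (hA i i)).trans
      (Finset.single_le_sum (f := fun k => (A ^ n) i k * A k i)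
        (fun k _ => mul_nonneg (pow_nonneg_apply hA n i k) (hA k i)) (Finset.mem_univ i))

open Filter Topology in
/-- The diagonal entries of the powers of a nonnegative matrix are bounded by the powers of its
spectral radius. -/
lemma pow_diag_le_specRadius_pow (hA : ∀ i j, 0 ≤ A i j) (i : Fin m) {a : ℕ} (ha : a ≠ 0) :
    (A ^ a) i i ≤ specRadius A ^ a := by
  obtain ⟨b, hb, hlim⟩ := tendsto_norm_entry_bound A
  have hr := pow_nonneg_apply hA a i i
  set r := (A ^ a) i i with hrdef
  -- Along the exponents `a(q + 1)`, the root of the lower bound `r ^ (q + 1)` is `r ^ (1 / a)`,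
  -- independent of `q`; the shift avoids exponent `0`.
  have hsub : Tendsto (fun q : ℕ => a * (q + 1)) atTop atTop :=
    (tendsto_id.const_mul_atTop' (Nat.pos_of_ne_zero ha)).comp (tendsto_add_atTop_nat 1)
  have h1 : r ^ (1 / a : ℝ) ≤ specRadius A := by
    refine ge_of_tendsto' (hlim.comp hsub) fun q => ?_
    have h2 : r ^ (q + 1) ≤ b (a * (q + 1)) := by
      refine le_trans ?_ ((le_abs_self _).trans (hb _ i i))
      rw [pow_mul]
      exact diag_pow_le (pow_nonneg_apply hA a) i _
    calc r ^ (1 / a : ℝ) = (r ^ (q + 1)) ^ (1 / ((a * (q + 1) : ℕ) : ℝ)) := by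
          rw [← Real.rpow_natCast, ← Real.rpow_mul hr]
          congr 1
          have : (a : ℝ) ≠ 0 := by exact_mod_cast ha
          have : (q + 1 : ℝ) ≠ 0 := by positivity
          push_cast
          field_simp
      _ ≤ _ := Real.rpow_le_rpow (pow_nonneg hr _) h2 (by positivity)
  calc r = (r ^ (1 / a : ℝ)) ^ a := by
        rw [one_div, Real.rpow_inv_natCast_pow hr ha]
    _ ≤ _ := pow_le_pow_left₀ (Real.rpow_nonneg hr _) h1 a

/-- The index `i` lies on a cycle of the graph of `A`. -/
def IsCyclic (A : Matrix (Fin m) (Fin m) ℝ) (i : Fin m) : Prop := ∃ p ≠ 0, 0 < (A ^ p) i i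

-- A successor of a non-cyclic index cannot lead back to it, hence is itself non-cyclic, and its set
-- of reachable indices is strictly smaller. A path is therefore shorter than the number of indices
-- its start reaches.
open Classical in
lemma lt_card_of_pow_pos (hA : ∀ i j, 0 ≤ A i j)
    (hcyc : ∀ i, IsCyclic A i → ∀ j, ∃ k, 0 < (A ^ k) i j) (k : ℕ) {l j : Fin m}
    (hl : ¬ IsCyclic A l) (h : 0 < (A ^ k) l j) :
    k < (Finset.univ.filter fun j => ∃ k, 0 < (A ^ k) l j).card := by
  induction k generalizing l with
  | zero => exact Finset.card_pos.2 ⟨l, by simpa using ⟨0, by simp⟩⟩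
  | succ k ih =>
    rw [pow_succ'] at h
    obtain ⟨l', h1, h2⟩ := exists_of_mul_pos hA (pow_nonneg_apply hA k) h
    have hback : ∀ n, ¬ 0 < (A ^ n) l' l := fun n hn => hl ⟨n + 1, by omega, by
      rw [pow_succ']; exact mul_pos_apply hA (pow_nonneg_apply hA n) h1 hn⟩
    have hl' : ¬ IsCyclic A l' := fun hc => by
      obtain ⟨n, hn⟩ := hcyc l' hc l
      exact hback n hn
    refine (Nat.succ_le_of_lt (ih hl' h2)).trans_lt (Finset.card_lt_card ?_)
    refine Finset.ssubset_iff_of_subset ?_ |>.2 ⟨l, by simpa using ⟨0, by simp⟩, by simpa using hback⟩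
    intro x hx
    simp only [Finset.mem_filter, Finset.mem_univ, true_and] at hx ⊢
    obtain ⟨n, hn⟩ := hx
    exact ⟨n + 1, by rw [pow_succ']; exact mul_pos_apply hA (pow_nonneg_apply hA n) h1 hn⟩

lemma pow_card_eq_zero (hA : ∀ i j, 0 ≤ A i j)
    (hcyc : ∀ i, IsCyclic A i → ∀ j, ∃ k, 0 < (A ^ k) i j) {l : Fin m} (hl : ¬ IsCyclic A l)
    (j : Fin m) : (A ^ m) l j = 0 := by
  classical
  refine le_antisymm (not_lt.1 fun h => ?_) (pow_nonneg_apply hA m l j)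
  have h1 := lt_card_of_pow_pos hA hcyc m hl h
  have h2 := Finset.card_le_univ (Finset.univ.filter fun j => ∃ k, 0 < (A ^ k) l j)
  simp only [Fintype.card_fin] at h2
  omega

/-- If every index on a cycle leads to all indices, then the powers of the matrix grow no faster
than the powers of its spectral radius. -/
lemma exists_pow_le_specRadius_pow (hA : ∀ i j, 0 ≤ A i j)
    (hcyc : ∀ i, IsCyclic A i → ∀ j, ∃ k, 0 < (A ^ k) i j) :
    ∃ C, 0 ≤ C ∧ ∀ k, m < k → ∀ i j, (A ^ k) i j ≤ C * specRadius A ^ k := by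
  set ρ := specRadius A with hρdef
  have hρ0 : 0 ≤ ρ := specRadius_nonneg A
  -- entries between cyclic indices
  have h1 : ∀ i l, ∃ c, 0 ≤ c ∧ (IsCyclic A i → IsCyclic A l →
      ∀ k, k ≠ 0 → (A ^ k) i l ≤ c * ρ ^ k) := by
    intro i l
    by_cases hl : IsCyclic A l
    · obtain ⟨n, hn⟩ := hcyc l hl i
      refine ⟨ρ ^ n / (A ^ n) l i, by positivity, fun _ _ k hk => ?_⟩
      rw [div_mul_eq_mul_div, le_div_iff₀ hn, ← pow_add, add_comm n k]
      refine le_trans ?_ (pow_diag_le_specRadius_pow hA i (by omega))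
      rw [pow_add, Matrix.mul_apply]
      exact Finset.single_le_sum (f := fun x => (A ^ k) i x * (A ^ n) x i)
        (fun x _ => mul_nonneg (pow_nonneg_apply hA k i x) (pow_nonneg_apply hA n x i))
        (Finset.mem_univ l)
    · exact ⟨0, le_rfl, fun _ h => absurd h hl⟩
  choose c hc0 hc using h1
  -- the spectral radius is positive as soon as there is a cycle
  have hρ : ∀ i, IsCyclic A i → 0 < ρ := fun i ⟨p, hp, hpos⟩ => by
    have := hpos.trans_le (pow_diag_le_specRadius_pow hA i hp)
    exact hρ0.lt_of_ne fun h0 => by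
      rw [← hρdef, ← h0, zero_pow hp] at this; exact lt_irrefl _ this
  have hbound : ∀ i j, ∃ C, 0 ≤ C ∧ ∀ k, m < k → (A ^ k) i j ≤ C * ρ ^ k := by
    intro i j
    by_cases hi : IsCyclic A i
    -- Split off the last `m` steps: rows of `A ^ m` at non-cyclic indices vanish, so only cyclic
    -- intermediate indices contribute.
    · refine ⟨∑ l, c i l * (A ^ m) l j / ρ ^ m, Finset.sum_nonneg fun l _ =>
        div_nonneg (mul_nonneg (hc0 i l) (pow_nonneg_apply hA m l j)) (by positivity),
        fun k hk => ?_⟩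
      obtain ⟨d, rfl⟩ := Nat.exists_eq_add_of_lt hk
      rw [show m + d + 1 = (d + 1) + m by ring, pow_add A, Matrix.mul_apply, Finset.sum_mul]
      refine Finset.sum_le_sum fun l _ => ?_
      by_cases hl : IsCyclic A l
      · have h2 := hc i l hi hl (d + 1) (by omega)
        have hm : ρ ^ m ≠ 0 := (pow_pos (hρ i hi) m).ne'
        calc (A ^ (d + 1)) i l * (A ^ m) l j ≤ c i l * ρ ^ (d + 1) * (A ^ m) l j :=
              mul_le_mul_of_nonneg_right h2 (pow_nonneg_apply hA m l j)
          _ = _ := by rw [pow_add ρ (d + 1) m]; field_simp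
      · rw [pow_card_eq_zero hA hcyc hl]; simp
    · refine ⟨0, le_rfl, fun k hk => ?_⟩
      rw [← Nat.add_sub_of_le hk.le, pow_add, Matrix.mul_apply]
      simp [pow_card_eq_zero hA hcyc hi]
  choose C hC0 hC using hbound
  refine ⟨∑ i, ∑ j, C i j, Finset.sum_nonneg fun i _ => Finset.sum_nonneg fun j _ => hC0 i j,
    fun k hk i j => (hC i j k hk).trans (mul_le_mul_of_nonneg_right ?_ (by positivity))⟩
  exact (Finset.single_le_sum (f := fun j => C i j) (fun j _ => hC0 i j) (Finset.mem_univ j)).trans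
    (Finset.single_le_sum (f := fun i => ∑ j, C i j)
      (fun i _ => Finset.sum_nonneg fun j _ => hC0 i j) (Finset.mem_univ i))

end PowerGrowth

/-! ### Cycles in the graph of `R` -/

section RateMatrix

variable {m : ℕ} {Am A0 Ap R : Matrix (Fin m) (Fin m) ℝ}

lemma R_pow_succ (hR : IsR Am A0 Ap R) (n : ℕ) :
    R ^ (n + 1) = R ^ n * Ap + R ^ (n + 1) * A0 + R ^ (n + 2) * Am := by
  calc R ^ (n + 1) = R ^ n * R := pow_succ R n
    _ = R ^ n * (Ap + R * A0 + R * R * Am) := by rw [← isR_eq hR]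
    _ = _ := by rw [pow_succ R (n + 1), pow_succ R n]; noncomm_ring

lemma R_pow_step (h : StochasticBlocks Am A0 Ap) (hR : IsR Am A0 Ap R) (n : ℕ) {i j l : Fin m}
    (hs : (0 < (R ^ n) i j ∧ 0 < Ap j l) ∨ (0 < (R ^ (n + 1)) i j ∧ 0 < A0 j l) ∨
      (0 < (R ^ (n + 2)) i j ∧ 0 < Am j l)) : 0 < (R ^ (n + 1)) i l := by
  have hp := pow_nonneg_apply hR.1
  have h1 := mul_nonneg_apply (hp n) h.up_nonneg i l
  have h2 := mul_nonneg_apply (hp (n + 1)) h.same_nonneg i l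
  have h3 := mul_nonneg_apply (hp (n + 2)) h.down_nonneg i l
  rw [R_pow_succ hR, Matrix.add_apply, Matrix.add_apply]
  rcases hs with ⟨ha, hb⟩ | ⟨ha, hb⟩ | ⟨ha, hb⟩
  · linarith [mul_pos_apply (hp n) h.up_nonneg ha hb]
  · linarith [mul_pos_apply (hp (n + 1)) h.same_nonneg ha hb]
  · linarith [mul_pos_apply (hp (n + 2)) h.down_nonneg ha hb]

/-- A path of the doubly infinite chain, lifted by `n` levels, is followed by the exponents of `R`
through `R_pow_succ`. This works as long as no step ends at an exponent below `1`, hence the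
threshold `D`. -/
lemma R_pow_pos_of_reaches (h : StochasticBlocks Am A0 Ap) (hR : IsR Am A0 Ap R) {i : Fin m}
    {y : ℤ × Fin m} (hy : Reaches (doublyInfinite Am A0 Ap) (0, i) y) :
    ∃ D : ℕ, ∀ n : ℕ, D ≤ n → 0 < (R ^ n) i i → ∀ t : ℕ, (t : ℤ) = n + y.1 →
      0 < (R ^ t) i y.2 := by
  induction hy with
  | refl =>
    refine ⟨0, fun n _ hn t ht => ?_⟩
    obtain rfl : t = n := by simpa using ht
    exact hn
  | @tail y z _ e ih =>
    obtain ⟨D, hD⟩ := ih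
    refine ⟨D + y.1.natAbs + z.1.natAbs + 1, fun n hn hpos t ht => ?_⟩
    obtain ⟨s, rfl⟩ : ∃ s, t = s + 1 := ⟨t - 1, by omega⟩
    have hD' := hD n (by omega) hpos
    refine R_pow_step h hR s ?_ (j := y.2)
    rcases doublyInfinite_pos e with ⟨h1, h2⟩ | ⟨h1, h2⟩ | ⟨h1, h2⟩
    · exact .inl ⟨hD' s (by omega), h2⟩
    · exact .inr (.inl ⟨hD' (s + 1) (by omega), h2⟩)
    · exact .inr (.inr ⟨hD' (s + 2) (by omega), h2⟩)

/-- Multiples of the cycle length provide arbitrarily high starting levels from which a path from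
`i` to `j` can be lifted. -/
lemma R_cyclic_reaches (h : StochasticBlocks Am A0 Ap) (hc : Connected Am A0 Ap)
    (hR : IsR Am A0 Ap R) (i : Fin m) (hi : IsCyclic R i) (j : Fin m) :
    ∃ k, 0 < (R ^ k) i j := by
  obtain ⟨p, hp, hpos⟩ := hi
  obtain ⟨D, hD⟩ := R_pow_pos_of_reaches h hR (hc (0, i) (0, j))
  refine ⟨p * D, hD (p * D) (Nat.le_mul_of_pos_left D (Nat.pos_of_ne_zero hp)) ?_ _ (by simp)⟩
  rw [pow_mul]
  exact (pow_pos hpos D).trans_le (diag_pow_le (pow_nonneg_apply hR.1 p) i D)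

end RateMatrix

/-! ### First passage and hitting probabilities -/

section FirstPassage

variable {S : Type*} [DecidableEq S] {P : Matrix S S ℝ}

omit [DecidableEq S] in
lemma IsStochastic.summable_mul (hP : IsStochastic P) (x : S) {u : S → ℝ}
    (hu : ∀ z, 0 ≤ u z ∧ u z ≤ 1) : Summable fun z => P x z * u z :=
  Summable.of_nonneg_of_le (fun z => mul_nonneg (hP.1 x z) (hu z).1)
    (fun z => mul_le_of_le_one_right (hP.1 x z) (hu z).2) (hP.2 x).summable

lemma IsStochastic.summable_ite_mul (hP : IsStochastic P) (x y : S) {u : S → ℝ}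
    (hu : ∀ z, 0 ≤ u z ∧ u z ≤ 1) : Summable fun z => if z = y then 0 else P x z * u z :=
  Summable.of_nonneg_of_le (fun z => by split_ifs; exacts [le_rfl, mul_nonneg (hP.1 x z) (hu z).1])
    (fun z => by split_ifs; exacts [mul_nonneg (hP.1 x z) (hu z).1, le_rfl]) (hP.summable_mul x hu)

lemma IsStochastic.add_tsum_ite (hP : IsStochastic P) (x y : S) {u : S → ℝ}
    (hu : ∀ z, 0 ≤ u z ∧ u z ≤ 1) :
    HasSum (fun z => P x z * if z = y then 1 else u z)
      (P x y + ∑' z, if z = y then 0 else P x z * u z) := by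
  have hs : Summable fun z => P x z * if z = y then 1 else u z :=
    hP.summable_mul x (u := fun z => if z = y then 1 else u z)
      fun z => by split_ifs; exacts [⟨zero_le_one, le_rfl⟩, hu z]
  have h := hs.hasSum
  rw [hs.tsum_eq_add_tsum_ite y] at h
  convert h using 2
  · simp
  · refine tsum_congr fun z => ?_
    split_ifs <;> simp_all

lemma IsStochastic.add_tsum_ite_le (hP : IsStochastic P) (x y : S) {u : S → ℝ}
    (hu : ∀ z, 0 ≤ u z ∧ u z ≤ 1) :
    P x y + ∑' z, (if z = y then 0 else P x z * u z) ≤ 1 :=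
  hasSum_le (fun z => mul_le_of_le_one_right (hP.1 x z)
    (by split_ifs; exacts [le_rfl, (hu z).2])) (hP.add_tsum_ite x y hu) (hP.2 x)

lemma firstPassage_mem (hP : IsStochastic P) (y : S) (n : ℕ) (x : S) :
    0 ≤ firstPassage P n x y ∧ firstPassage P n x y ≤ 1 := by
  induction n generalizing x with
  | zero => exact ⟨hP.1 x y, le_hasSum (hP.2 x) y fun z _ => hP.1 x z⟩
  | succ n ih =>
    refine ⟨tsum_nonneg fun z => ?_, ?_⟩
    · split_ifs; exacts [le_rfl, mul_nonneg (hP.1 x z) (ih z).1]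
    · have := hP.add_tsum_ite_le x y ih
      have := hP.1 x y
      simp only [firstPassage]
      linarith

/-- First-step decomposition of the probability of visiting `y` within `n + 1` steps. -/
lemma sum_firstPassage_succ (hP : IsStochastic P) (y : S) (n : ℕ) (x : S) :
    ∑ k ∈ Finset.range (n + 1), firstPassage P k x y =
      P x y + ∑' z, if z = y then 0 else P x z * ∑ k ∈ Finset.range n, firstPassage P k z y := by
  rw [Finset.sum_range_succ', add_comm]
  congr 1
  simp only [firstPassage]
  rw [← Summable.tsum_finsetSum fun k _ => hP.summable_ite_mul x y (firstPassage_mem hP y k)]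
  refine tsum_congr fun z => ?_
  split_ifs
  · simp
  · rw [Finset.mul_sum]

lemma sum_firstPassage_mem (hP : IsStochastic P) (y : S) (n : ℕ) (x : S) :
    0 ≤ ∑ k ∈ Finset.range n, firstPassage P k x y ∧
      ∑ k ∈ Finset.range n, firstPassage P k x y ≤ 1 := by
  refine ⟨Finset.sum_nonneg fun k _ => (firstPassage_mem hP y k x).1, ?_⟩
  induction n generalizing x with
  | zero => simp
  | succ n ih =>
    rw [sum_firstPassage_succ hP]
    exact hP.add_tsum_ite_le x y
      fun z => ⟨Finset.sum_nonneg fun k _ => (firstPassage_mem hP y k z).1, ih z⟩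

open Filter Topology in
/-- The hitting probabilities of `y` and the first step equation that they satisfy. -/
lemma exists_hitting (hP : IsStochastic P) (y : S) :
    ∃ h : S → ℝ, (∀ x, HasSum (fun n => firstPassage P n x y) (h x)) ∧
      (∀ x, 0 ≤ h x ∧ h x ≤ 1) ∧
      ∀ x, HasSum (fun z => P x z * if z = y then 1 else h z) (h x) := by
  have hs : ∀ x, Summable fun n => firstPassage P n x y := fun x =>
    summable_of_sum_range_le (fun n => (firstPassage_mem hP y n x).1)
      fun n => (sum_firstPassage_mem hP y n x).2
  have ht := fun x => (hs x).hasSum.tendsto_sum_nat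
  set h : S → ℝ := fun x => ∑' n, firstPassage P n x y with hh
  have hmem : ∀ x, 0 ≤ h x ∧ h x ≤ 1 := fun x =>
    ⟨ge_of_tendsto' (ht x) fun n => (sum_firstPassage_mem hP y n x).1,
      le_of_tendsto' (ht x) fun n => (sum_firstPassage_mem hP y n x).2⟩
  refine ⟨h, fun x => (hs x).hasSum, hmem, fun x => ?_⟩
  -- Dominated convergence, with the summable row `P x ·` as dominating function.
  have hlim : Tendsto (fun n => ∑' z, if z = y then 0 else
      P x z * ∑ k ∈ Finset.range n, firstPassage P k z y) atTop
      (𝓝 (∑' z, if z = y then 0 else P x z * h z)) := by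
    refine tendsto_tsum_of_dominated_convergence (hP.2 x).summable (fun z => ?_)
      (Eventually.of_forall fun n z => ?_)
    · split_ifs
      · exact tendsto_const_nhds
      · exact (ht z).const_mul _
    · have hz := sum_firstPassage_mem hP y n z
      split_ifs
      · simpa using hP.1 x z
      · rw [Real.norm_of_nonneg (mul_nonneg (hP.1 x z) hz.1)]
        exact mul_le_of_le_one_right (hP.1 x z) hz.2
  have heq : h x = P x y + ∑' z, if z = y then 0 else P x z * h z := by
    refine tendsto_nhds_unique ((ht x).comp (tendsto_add_atTop_nat 1)) ?_
    refine (hlim.const_add (P x y)).congr fun n => ?_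
    exact (sum_firstPassage_succ hP y n x).symm
  rw [heq]
  exact hP.add_tsum_ite x y hmem

omit [DecidableEq S] in
/-- A superharmonic function of an irreducible chain which attains its minimum is constant. -/
lemma eq_of_superharmonic_of_min (hP : IsStochastic P) (hirr : P.IsIrreducible) {s t : S → ℝ}
    (ht : ∀ x, HasSum (fun z => P x z * s z) (t x)) (hts : ∀ x, t x ≤ s x) {x₀ : S}
    (hmin : ∀ x, s x₀ ≤ s x) (y : S) : s y = s x₀ := by
  refine mem_of_isIrreducible hirr (T := {x | s x = s x₀}) (fun x hx z hz => ?_) rfl y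
  -- The terms `P x z (s z - s x₀)` are nonnegative with sum `t x - s x₀ ≤ s x - s x₀ = 0`, so each
  -- one vanishes.
  have h1 := (ht x).sub ((hP.2 x).mul_right (s x₀))
  have h2 : ∀ z, 0 ≤ P x z * s z - P x z * s x₀ := fun z => by
    rw [← mul_sub]; exact mul_nonneg (hP.1 x z) (sub_nonneg.2 (hmin z))
  have h3 : t x - 1 * s x₀ = 0 := by
    refine le_antisymm ?_ (h1.nonneg h2)
    have : s x = s x₀ := hx
    linarith [hts x]
  rw [h3, hasSum_zero_iff_of_nonneg h2] at h1
  have h4 : P x z * s z - P x z * s x₀ = 0 := congrFun h1 z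
  rw [← mul_sub] at h4
  exact sub_eq_zero.1 ((mul_eq_zero.1 h4).resolve_left hz.ne')

end FirstPassage

/-! ### Real matrices acting on real or complex vectors -/

section Act

variable {m : ℕ} {𝕜 : Type*} [RCLike 𝕜]

lemma act_apply (M : Matrix (Fin m) (Fin m) ℝ) (v : Fin m → 𝕜) (i : Fin m) :
    act M v i = ∑ j, M i j • v j := by
  simp [act, Matrix.mulVec, dotProduct, Algebra.smul_def]

lemma act_real (M : Matrix (Fin m) (Fin m) ℝ) (v : Fin m → ℝ) : act M v = M *ᵥ v := by
  ext i; simp [act_apply, Matrix.mulVec, dotProduct]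

lemma act_add (M : Matrix (Fin m) (Fin m) ℝ) (v w : Fin m → 𝕜) :
    act M (v + w) = act M v + act M w := Matrix.mulVec_add ..

lemma act_neg (M : Matrix (Fin m) (Fin m) ℝ) (v : Fin m → 𝕜) : act M (-v) = -act M v :=
  Matrix.mulVec_neg ..

lemma add_act (M N : Matrix (Fin m) (Fin m) ℝ) (v : Fin m → 𝕜) :
    act (M + N) v = act M v + act N v := by
  ext i; simp [act_apply, add_smul, Finset.sum_add_distrib]

lemma sub_act (M N : Matrix (Fin m) (Fin m) ℝ) (v : Fin m → 𝕜) :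
    act (M - N) v = act M v - act N v := by
  ext i; simp [act_apply, sub_smul, Finset.sum_sub_distrib]

lemma neg_act (M : Matrix (Fin m) (Fin m) ℝ) (v : Fin m → 𝕜) : act (-M) v = -act M v := by
  ext i; simp [act_apply]

lemma one_act (v : Fin m → 𝕜) : act (1 : Matrix (Fin m) (Fin m) ℝ) v = v := by
  ext i; simp [act_apply, Matrix.one_apply]

lemma mul_act (M N : Matrix (Fin m) (Fin m) ℝ) (v : Fin m → 𝕜) :
    act (M * N) v = act M (act N v) := by
  rw [act, act, act, Matrix.mulVec_mulVec, Matrix.map_mul]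

lemma act_sum {α : Type*} (s : Finset α) (M : Matrix (Fin m) (Fin m) ℝ) (v : α → Fin m → 𝕜) :
    act M (∑ a ∈ s, v a) = ∑ a ∈ s, act M (v a) :=
  map_sum (Matrix.mulVecLin (M.map (algebraMap ℝ 𝕜))) v s

lemma continuous_act (M : Matrix (Fin m) (Fin m) ℝ) :
    Continuous (act M : (Fin m → 𝕜) → Fin m → 𝕜) := by
  unfold act; fun_prop

lemma hasSum_act {α : Type*} (M : Matrix (Fin m) (Fin m) ℝ) {v : α → Fin m → 𝕜}
    {w : Fin m → 𝕜} (h : HasSum v w) : HasSum (fun a => act M (v a)) (act M w) :=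
  h.map (Matrix.mulVecLin (M.map (algebraMap ℝ 𝕜))) (continuous_act M)

end Act

/-! ### Rows of the QBD, and recurrence from level 0 -/

section Transition

variable {m : ℕ} {B Am A0 Ap G : Matrix (Fin m) (Fin m) ℝ} {𝕜 : Type*} [RCLike 𝕜]

lemma hasSum_transition_zero (B Am A0 Ap : Matrix (Fin m) (Fin m) ℝ) (w : ℕ → Fin m → 𝕜)
    (i : Fin m) : HasSum (fun y : ℕ × Fin m => transition B Am A0 Ap (0, i) y • w y.1 y.2)
      ((act B (w 0) + act Ap (w 1)) i) := by
  have h := hasSum_sum_of_ne_finset_zero (L := .unconditional _)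
    (f := fun y : ℕ × Fin m => transition B Am A0 Ap (0, i) y • w y.1 y.2)
    (s := ({0, 1} : Finset ℕ) ×ˢ Finset.univ) (fun y hy => by
      simp only [Finset.mem_product, Finset.mem_insert, Finset.mem_singleton, Finset.mem_univ,
        and_true, not_or] at hy
      simp [transition, hy])
  rw [Finset.sum_product, Finset.sum_pair (by decide)] at h
  simpa [transition, act_apply] using h

lemma hasSum_transition_succ (B Am A0 Ap : Matrix (Fin m) (Fin m) ℝ) (w : ℕ → Fin m → 𝕜)
    (n : ℕ) (i : Fin m) :
    HasSum (fun y : ℕ × Fin m => transition B Am A0 Ap (n + 1, i) y • w y.1 y.2)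
      ((act Am (w n) + act A0 (w (n + 1)) + act Ap (w (n + 2))) i) := by
  have h := hasSum_sum_of_ne_finset_zero (L := .unconditional _)
    (f := fun y : ℕ × Fin m => transition B Am A0 Ap (n + 1, i) y • w y.1 y.2)
    (s := ({n, n + 1, n + 2} : Finset ℕ) ×ˢ Finset.univ) (fun y hy => by
      simp only [Finset.mem_product, Finset.mem_insert, Finset.mem_singleton, Finset.mem_univ,
        and_true, not_or] at hy
      simp [transition, hy])
  rw [Finset.sum_product, Finset.sum_insert (by simp), Finset.sum_pair (by simp),
    ← add_assoc] at h
  simpa [transition, act_apply, show ¬ n = n + 1 + 1 by omega] using h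

lemma boundary_nonneg (hP : IsStochastic (transition B Am A0 Ap)) (i j : Fin m) : 0 ≤ B i j := by
  simpa [transition] using hP.1 (0, i) (0, j)

lemma stochasticBlocks_of_transition (hP : IsStochastic (transition B Am A0 Ap)) :
    StochasticBlocks Am A0 Ap where
  down_nonneg i j := by simpa [transition] using hP.1 (1, i) (0, j)
  same_nonneg i j := by simpa [transition] using hP.1 (1, i) (1, j)
  up_nonneg i j := by simpa [transition] using hP.1 (0, i) (1, j)
  row_sum := by
    ext i
    have h := hasSum_transition_succ B Am A0 Ap (fun _ _ => (1 : ℝ)) 0 i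
    simp only [smul_eq_mul, mul_one, act_real] at h
    exact h.unique (hP.2 _)

lemma boundary_row_sum (hP : IsStochastic (transition B Am A0 Ap)) :
    B *ᵥ 1 + Ap *ᵥ 1 = 1 := by
  ext i
  have h := hasSum_transition_zero B Am A0 Ap (fun _ _ => (1 : ℝ)) i
  simp only [smul_eq_mul, mul_one, act_real] at h
  exact h.unique (hP.2 _)

lemma pStar_nonneg (hP : IsStochastic (transition B Am A0 Ap)) (hG : IsG Am A0 Ap G)
    (i j : Fin m) : 0 ≤ pStar B Ap G i j :=
  add_nonneg (boundary_nonneg hP i j)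
    (mul_nonneg_apply (stochasticBlocks_of_transition hP).up_nonneg hG.1 i j)

lemma pStar_row_sum_le (hP : IsStochastic (transition B Am A0 Ap)) (hG : IsG Am A0 Ap G)
    (i : Fin m) : ∑ j, pStar B Ap G i j ≤ 1 := by
  have h1 := up_G_row_sum_le (stochasticBlocks_of_transition hP) hG i
  have h2 := congrFun (boundary_row_sum hP) i
  rw [← mulVec_one_apply, pStar, Matrix.add_mulVec]
  simp only [Pi.add_apply, Pi.one_apply] at h2 ⊢
  linarith

/-- The defect `d = 1 - G1` satisfies `A₁d = 0` because `P⁎1 = 1`; the equation of `G` then gives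
`Vd = d`, so `d = 0`. -/
lemma G_mulVec_one_of_pStar (hP : IsStochastic (transition B Am A0 Ap)) (hc : Connected Am A0 Ap)
    (hG : IsG Am A0 Ap G) (h1 : pStar B Ap G *ᵥ 1 = 1) : G *ᵥ 1 = 1 := by
  have h := stochasticBlocks_of_transition hP
  have hup : Ap *ᵥ (G *ᵥ 1) = Ap *ᵥ 1 := by
    have h2 := h1.trans (boundary_row_sum hP).symm
    rw [pStar, Matrix.add_mulVec, ← Matrix.mulVec_mulVec] at h2
    exact add_left_cancel h2
  have hGG : G *ᵥ 1 = Am *ᵥ 1 + A0 *ᵥ (G *ᵥ 1) + (Ap * G) *ᵥ (G *ᵥ 1) := by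
    nth_rw 1 [isG_eq hG]
    simp only [Matrix.add_mulVec, Matrix.mulVec_mulVec]
  have hd : taboo A0 Ap G *ᵥ (1 - G *ᵥ 1) = 1 - G *ᵥ 1 := by
    rw [Matrix.mulVec_sub, taboo, Matrix.add_mulVec, Matrix.add_mulVec, ← Matrix.mulVec_mulVec _ Ap G,
      hup]
    nth_rw 3 [hGG]
    nth_rw 5 [← h.row_sum]
    abel
  exact (sub_eq_zero.1 (eq_zero_of_mulVec_eq (taboo_nonneg h hG) (taboo_row_sum_le_one h hG)
    (taboo_noTrap h hc hG) hd)).symm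

/-- The process is recurrent when the censored process on level `0` is stochastic. -/
lemma isRecurrent_of_pStar (hP : IsStochastic (transition B Am A0 Ap))
    (hirr : (transition B Am A0 Ap).IsIrreducible) (hc : Connected Am A0 Ap)
    (hG : IsG Am A0 Ap G) (h1 : pStar B Ap G *ᵥ 1 = 1) :
    IsRecurrent (transition B Am A0 Ap) := by
  intro y
  have hb := stochasticBlocks_of_transition hP
  obtain ⟨h, hsum, hmem, hstep⟩ := exists_hitting hP y
  -- Raising the hitting probability to `1` at `y` gives `Ps = h ≤ s`, so `s` is superharmonic
  -- everywhere.
  set s : ℕ × Fin m → ℝ := fun z => if z = y then 1 else h z with hs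
  have hs0 : ∀ z, 0 ≤ s z := fun z => by
    simp only [hs]; split_ifs; exacts [zero_le_one, (hmem z).1]
  have hle : ∀ z, h z ≤ s z := fun z => by
    simp only [hs]; split_ifs; exacts [(hmem z).2, le_rfl]
  have hGs := G_mulVec_le_of_superharmonic hb hG (s := fun n i => s (n, i)) (fun n i => hs0 _)
    (fun n i => by
      have := hasSum_transition_succ B Am A0 Ap (fun n i => s (n, i)) n i
      simp only [smul_eq_mul, act_real] at this
      rw [this.unique (hstep (n + 1, i))]
      exact hle _)
  have hne : Nonempty (Fin m) := ⟨y.2⟩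
  obtain ⟨i₀, hi₀⟩ := Finite.exists_min fun i => s (0, i)
  have hP1 : ∀ i, ∑ j, pStar B Ap G i j = 1 := fun i => by
    rw [← mulVec_one_apply, h1, Pi.one_apply]
  have hP0 : ∀ i, (pStar B Ap G *ᵥ fun j => s (0, j)) i ≤ s (0, i) := fun i => by
    have := hasSum_transition_zero B Am A0 Ap (fun n i => s (n, i)) i
    simp only [smul_eq_mul, act_real] at this
    refine le_trans ?_ ((this.unique (hstep (0, i))).le.trans (hle _))
    rw [pStar, Matrix.add_mulVec, ← Matrix.mulVec_mulVec, Pi.add_apply, Pi.add_apply]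
    exact add_le_add le_rfl (mulVec_mono hb.up_nonneg (hGs 0) i)
  -- On level `0`, `s` is superharmonic for `P⁎`, which is stochastic and irreducible; hence it is
  -- constant there.
  have hlevel0 : ∀ i, s (0, i) = s (0, i₀) := fun i => by
    refine pStar_closed hb (boundary_nonneg hP) hirr hG (S := {i | s (0, i) = s (0, i₀)})
      (fun i hi j hij => ?_) rfl i
    have hi' : s (0, i) = s (0, i₀) := hi
    exact ((eq_of_mulVec_le_of_min (pStar_nonneg hP hG) (x := fun j => s (0, j))
      (fun j => hi'.le.trans (hi₀ j)) (hP0 i) (by rw [hP1, one_mul])).2 j hij).trans hi'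
  have hG1 := G_mulVec_one_of_pStar hP hc hG h1
  -- Since `G1 = 1`, a lower bound on one level passes to the next, so the global minimum is
  -- attained on level `0`.
  have hmin : ∀ n i, s (0, i₀) ≤ s (n, i) := fun n => by
    induction n with
    | zero => exact hi₀
    | succ n ih =>
      intro i
      refine le_trans ?_ (hGs n i)
      refine le_trans (le_of_eq ?_) (mulVec_mono hG.1 (x := s (0, i₀) • 1)
        (fun j => by simpa using ih j) i)
      rw [Matrix.mulVec_smul, hG1]; simp
  have hconst : ∀ x, s x = s (0, i₀) := eq_of_superharmonic_of_min hP hirr hstep hle (fun x => hmin x.1 x.2)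
  have hs1 : ∀ x, s x = 1 := fun x =>
    (hconst x).trans ((hconst y).symm.trans (by simp [hs]))
  have hy : h y = 1 := by
    refine (hstep y).unique ?_
    have := hP.2 y
    simpa only [show ∀ z, (if z = y then 1 else h z) = 1 from hs1, mul_one] using this
  exact hy ▸ hsum y

end Transition

/-! ### Stationary distributions and group inverses -/

section GroupInverse

variable {m : ℕ} {Q : Matrix (Fin m) (Fin m) ℝ}

lemma isGroupInverse_groupInverse {H D : Matrix (Fin m) (Fin m) ℝ} (h : IsGroupInverse H D) :
    IsGroupInverse H (groupInverse H) := by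
  have hex : ∃ D, IsGroupInverse H D := ⟨D, h⟩
  rw [groupInverse, dif_pos hex]
  exact hex.choose_spec

lemma isGroupInverse_inv {H : Matrix (Fin m) (Fin m) ℝ} (h : IsUnit H) :
    IsGroupInverse H H⁻¹ := by
  have hd := (Matrix.isUnit_iff_isUnit_det _).1 h
  refine ⟨?_, ?_, ?_⟩ <;> simp [Matrix.mul_nonsing_inv _ hd, Matrix.nonsing_inv_mul _ hd]

/-- A left null vector `u` of `1 - Q` satisfies `|u| ≤ |u|Q` entrywise. Both sides have the same
total mass, so `|u|` is invariant and can be normalised. -/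
lemma exists_isStationaryDistribution (hne : Nonempty (Fin m)) (hQ : ∀ i j, 0 ≤ Q i j)
    (h1 : Q *ᵥ 1 = 1) : ∃ p, IsStationaryDistribution Q p := by
  obtain ⟨u, hu0, hu⟩ : ∃ u, u ≠ 0 ∧ u ᵥ* (1 - Q) = 0 := by
    rw [Matrix.exists_vecMul_eq_zero_iff, ← Matrix.exists_mulVec_eq_zero_iff]
    exact ⟨1, one_ne_zero, by rw [Matrix.sub_mulVec, h1, Matrix.one_mulVec, sub_self]⟩
  have hu' : ∀ j, ∑ i, u i * Q i j = u j := fun j => by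
    rw [Matrix.vecMul_sub, Matrix.vecMul_one, sub_eq_zero] at hu
    exact (congrFun hu j).symm
  have hle : ∀ j ∈ Finset.univ, |u j| ≤ ∑ i, |u i| * Q i j := fun j _ => by
    rw [← hu' j]
    refine (Finset.abs_sum_le_sum_abs _ _).trans (le_of_eq (Finset.sum_congr rfl fun i _ => ?_))
    rw [abs_mul, abs_of_nonneg (hQ i j)]
  have hrow : ∀ i, ∑ j, Q i j = 1 := fun i => by
    rw [← mulVec_one_apply, h1, Pi.one_apply]
  have htot : ∑ j, ∑ i, |u i| * Q i j = ∑ i, |u i| := by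
    rw [Finset.sum_comm]
    exact Finset.sum_congr rfl fun i _ => by rw [← Finset.mul_sum, hrow, mul_one]
  have heq : ∀ j, |u j| = ∑ i, |u i| * Q i j := fun j =>
    (Finset.sum_eq_sum_iff_of_le hle).1 htot.symm j (Finset.mem_univ j)
  have hpos : 0 < ∑ i, |u i| := by
    obtain ⟨i, hi⟩ := Function.ne_iff.1 hu0
    exact Finset.sum_pos' (fun i _ => abs_nonneg _) ⟨i, Finset.mem_univ i, abs_pos.2 hi⟩
  refine ⟨fun i => |u i| / ∑ i, |u i|, fun i => by positivity, ?_, ?_⟩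
  · rw [Matrix.vecMul_sub, Matrix.vecMul_one, sub_eq_zero]
    ext j
    rw [heq j, Finset.sum_div]
    exact Finset.sum_congr rfl fun i _ => by ring
  · rw [← Finset.sum_div, div_self hpos.ne']

/-- The group inverse of `1 - Q` for an irreducible stochastic matrix `Q`. -/
lemma exists_isGroupInverse (hne : Nonempty (Fin m)) (hQ : ∀ i j, 0 ≤ Q i j)
    (h1 : Q *ᵥ 1 = 1)
    (hcl : ∀ S : Set (Fin m), (∀ i ∈ S, ∀ j, 0 < Q i j → j ∈ S) → ∀ i ∈ S, ∀ j, j ∈ S) :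
    ∃ p D, IsStationaryDistribution Q p ∧ IsGroupInverse (1 - Q) D ∧
      (1 - Q) * D = 1 - Matrix.vecMulVec 1 p := by
  obtain ⟨p, hp⟩ := exists_isStationaryDistribution hne hQ h1
  have hp1 : p ⬝ᵥ 1 = 1 := by simpa [dotProduct] using hp.2.2
  set E : Matrix (Fin m) (Fin m) ℝ := Matrix.vecMulVec 1 p with hE
  set H := 1 - Q with hH
  have hEx : ∀ x, E *ᵥ x = (p ⬝ᵥ x) • 1 := fun x => by
    ext i; simp [hE, Matrix.mulVec, dotProduct]
  have hH1 : H *ᵥ 1 = 0 := by rw [hH, Matrix.sub_mulVec, h1, Matrix.one_mulVec, sub_self]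
  have hEE : E * E = E := by
    rw [hE, Matrix.vecMulVec_mul_vecMulVec, hp1]; simp
  have hHE : H * E = 0 := by rw [hE, Matrix.mul_vecMulVec, hH1, Matrix.zero_vecMulVec]
  have hEH : E * H = 0 := by
    rw [hE, Matrix.vecMulVec_mul, hp.2.1, Matrix.vecMulVec_zero]
  have hrow : ∀ i, ∑ j, Q i j = 1 := fun i => by
    rw [← mulVec_one_apply, h1, Pi.one_apply]
  -- Applying `E` to a kernel vector shows that `E` kills it. It is then harmonic, hence constant,
  -- and its `p`-mean is zero.
  have hu : IsUnit (H + E) := by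
    rw [← Matrix.mulVec_injective_iff_isUnit, ← Matrix.coe_mulVecLin, injective_iff_map_eq_zero]
    intro x hx
    rw [Matrix.mulVecLin_apply] at hx
    have hEx0 : E *ᵥ x = 0 := by
      have := congrArg (E *ᵥ ·) hx
      simpa [Matrix.mulVec_mulVec, mul_add, hEE, hEH] using this
    rw [Matrix.add_mulVec, hEx0, add_zero, hH, Matrix.sub_mulVec, Matrix.one_mulVec,
      sub_eq_zero] at hx
    obtain ⟨i₀, h₀⟩ := Finite.exists_min x
    have hc : ∀ i, x i = x i₀ := fun i => by
      refine hcl {i | x i = x i₀} (fun i hi j hij => ?_) i₀ rfl i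
      have hi' : x i = x i₀ := hi
      exact ((eq_of_mulVec_le_of_min hQ (fun j => hi'.le.trans (h₀ j)) (congrFun hx i).symm.le
        (by rw [hrow, one_mul])).2 j hij).trans hi'
    have hx' : x = x i₀ • 1 := by ext i; simp [hc i]
    rw [hEx, hx', dotProduct_smul, hp1] at hEx0
    have h0 := congrFun hEx0 i₀
    simp only [smul_eq_mul, mul_one, Pi.smul_apply, Pi.one_apply, Pi.zero_apply] at h0
    rw [hx', h0, zero_smul]
  have hd := (Matrix.isUnit_iff_isUnit_det _).1 hu
  -- `Z` is the fundamental matrix; the group inverse is `Z - E`.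
  set Z := (H + E)⁻¹ with hZ
  have hMZ : (H + E) * Z = 1 := Matrix.mul_nonsing_inv _ hd
  have hZM : Z * (H + E) = 1 := Matrix.nonsing_inv_mul _ hd
  have hZE : Z * E = E := by
    have : (H + E) * E = E := by rw [add_mul, hHE, hEE, zero_add]
    nth_rw 1 [← this]
    rw [← mul_assoc, hZM, one_mul]
  have hEZ : E * Z = E := by
    have : E * (H + E) = E := by rw [mul_add, hEH, hEE, zero_add]
    nth_rw 1 [← this]
    rw [mul_assoc, hMZ, mul_one]
  have hHD : H * (Z - E) = 1 - E := by
    rw [mul_sub, hHE, sub_zero, ← hMZ, add_mul, hEZ, add_sub_cancel_right]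
  have hDH : (Z - E) * H = 1 - E := by
    rw [sub_mul, hEH, sub_zero, ← hZM, mul_add, hZE, add_sub_cancel_right]
  refine ⟨p, Z - E, hp, ⟨hHD.trans hDH.symm, ?_, ?_⟩, hHD⟩
  · rw [hHD, sub_mul, one_mul, hEH, sub_zero]
  · rw [hDH, sub_mul, one_mul, mul_sub, hEZ, hEE, sub_self, sub_zero]

end GroupInverse

/-! ### Convergence of the series and the recursion for `y_r` -/

section Series

variable {m : ℕ} {𝕜 : Type*} [RCLike 𝕜]

lemma norm_act_le {M : Matrix (Fin m) (Fin m) ℝ} {c : ℝ} (hc : 0 ≤ c)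
    (hM : ∀ i j, |M i j| ≤ c) (v : Fin m → 𝕜) : ‖act M v‖ ≤ m * c * ‖v‖ := by
  refine (pi_norm_le_iff_of_nonneg (by positivity)).2 fun i => ?_
  rw [act_apply]
  refine (norm_sum_le_of_le Finset.univ (fun j _ => (norm_smul_le _ _).trans
    (mul_le_mul (hM i j) (norm_le_pi_norm v j) (norm_nonneg _) hc))).trans (le_of_eq ?_)
  rw [Finset.sum_const, Finset.card_univ, Fintype.card_fin, nsmul_eq_mul, mul_assoc]

/-- Summability of the shifted series `∑ Rᵏ gₙ₊ₖ`. -/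
lemma summable_act_pow_shift {R : Matrix (Fin m) (Fin m) ℝ} (hR : ∀ i j, 0 ≤ R i j)
    (hcyc : ∀ i, IsCyclic R i → ∀ j, ∃ k, 0 < (R ^ k) i j) {g : ℕ → Fin m → 𝕜}
    (hg : Summable fun k : ℕ => specRadius R ^ k * ‖g k‖) (n : ℕ) :
    Summable fun k => act (R ^ k) (g (n + k)) := by
  obtain ⟨C, hC0, hC⟩ := exists_pow_le_specRadius_pow hR hcyc
  have hρ0 := specRadius_nonneg R
  have hbound : ∀ k, m < k → ‖act (R ^ k) (g (n + k))‖ ≤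
      m * (C * specRadius R ^ k) * ‖g (n + k)‖ := fun k hk =>
    norm_act_le (by positivity) (fun i j => by
      rw [abs_of_nonneg (pow_nonneg_apply hR k i j)]; exact hC k hk i j) _
  rcases hρ0.eq_or_lt with h0 | hpos
  -- When `ρ(R) = 0` the weights do not control `g`, but the growth bound makes every term with `k >
  -- m` vanish.
  · refine summable_of_ne_finset_zero (s := Finset.range (m + 1)) fun k hk => ?_
    rw [Finset.mem_range, not_lt] at hk
    have := hbound k (by omega)
    rw [← h0, zero_pow (by omega)] at this
    simpa using this
  · have h1 : Summable fun k => m * (C * specRadius R ^ k) * ‖g (n + k)‖ := by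
      have h2 := ((summable_nat_add_iff n).2 hg).mul_left (m * C / specRadius R ^ n)
      refine h2.congr fun k => ?_
      rw [pow_add, add_comm k n]
      have : specRadius R ^ n ≠ 0 := (pow_pos hpos n).ne'
      field_simp
    refine Summable.of_norm_bounded_eventually_nat h1 ?_
    filter_upwards [Filter.eventually_gt_atTop m] with k hk using hbound k hk

variable {Am A0 Ap G R : Matrix (Fin m) (Fin m) ℝ} {g : ℕ → Fin m → 𝕜}

/-- The tail series `∑ Rᵏ gₙ₊ₖ`. -/
noncomputable def tailSum (R : Matrix (Fin m) (Fin m) ℝ) (g : ℕ → Fin m → 𝕜) (n : ℕ) : Fin m → 𝕜 :=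
  ∑' k, act (R ^ k) (g (n + k))

lemma tailSum_eq (hs : ∀ n, Summable fun k => act (R ^ k) (g (n + k))) (n : ℕ) :
    tailSum R g n = g n + act R (tailSum R g (n + 1)) := by
  rw [tailSum, (hs n).tsum_eq_zero_add, pow_zero, one_act, add_zero]
  congr 1
  have h := hasSum_act R (hs (n + 1)).hasSum
  refine Eq.trans (tsum_congr fun k => ?_) h.tsum_eq
  rw [pow_succ', mul_act, add_assoc, add_comm 1 k]

lemma hasSum_yTerm (hs : ∀ n, Summable fun k => act (R ^ k) (g (n + k))) (r : ℕ) :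
    HasSum (fun k => yTerm Am A0 G R g r k)
      (∑ j ∈ Finset.range r, act (G ^ j * (matU Am A0 R - 1)⁻¹) (tailSum R g (r - j))) := by
  unfold yTerm
  refine hasSum_sum fun j hj => ?_
  have h := hasSum_act (G ^ j * (matU Am A0 R - 1)⁻¹) (hs (r - j)).hasSum
  refine (congrArg (fun f => HasSum f _) (funext fun k => ?_)).mp h
  rw [← mul_act, ← Nat.sub_add_comm (Finset.mem_range.1 hj).le]

lemma yVec_zero : yVec Am A0 G R g 0 = 0 := by
  simp [yVec, yTerm]

/-- The index `j = 0` gives the new term, and a factor `G` comes out of the others. -/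
lemma yVec_succ (hs : ∀ n, Summable fun k => act (R ^ k) (g (n + k))) (r : ℕ) :
    yVec Am A0 G R g (r + 1) =
      -act (matU Am A0 R - 1)⁻¹ (tailSum R g (r + 1)) + act G (yVec Am A0 G R g r) := by
  rw [yVec, yVec, (hasSum_yTerm hs _).tsum_eq, (hasSum_yTerm hs _).tsum_eq,
    Finset.sum_range_succ', act_neg, act_sum, neg_add, add_comm]
  congr 2
  · simp
  · refine Finset.sum_congr rfl fun j _ => ?_
    rw [← mul_act, Nat.add_sub_add_right, pow_succ', mul_assoc]

end Series

/-! ### Verification of the Poisson equation -/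

section Poisson

variable {m : ℕ} {𝕜 : Type*} [RCLike 𝕜] {B Am A0 Ap G R : Matrix (Fin m) (Fin m) ℝ}
  {g : ℕ → Fin m → 𝕜}

lemma solvesPoisson_of_rows {w : ℕ → Fin m → 𝕜}
    (h0 : w 0 = act B (w 0) + act Ap (w 1) + g 0)
    (h1 : ∀ n, w (n + 1) = act Am (w n) + act A0 (w (n + 1)) + act Ap (w (n + 2)) + g (n + 1)) :
    SolvesPoisson (transition B Am A0 Ap) (fun x => w x.1 x.2) (fun x => g x.1 x.2) := by
  rintro ⟨n, i⟩
  have hid : HasSum (fun y : ℕ × Fin m => (1 : Matrix (ℕ × Fin m) (ℕ × Fin m) ℝ) (n, i) y •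
      w y.1 y.2) (w n i) := by
    have h := hasSum_single (f := fun y : ℕ × Fin m =>
      (1 : Matrix (ℕ × Fin m) (ℕ × Fin m) ℝ) (n, i) y • w y.1 y.2) (n, i)
      (fun y hy => by simp [Matrix.one_apply_ne hy.symm])
    simpa using h
  simp only [Matrix.sub_apply, sub_smul]
  cases n with
  | zero =>
    have h := hid.sub (hasSum_transition_zero B Am A0 Ap w i)
    rwa [show w 0 i - (act B (w 0) + act Ap (w 1)) i = g 0 i by
      rw [sub_eq_iff_eq_add', ← Pi.add_apply, ← h0]] at h
  | succ n =>
    have h := hid.sub (hasSum_transition_succ B Am A0 Ap w n i)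
    rwa [show w (n + 1) i - (act Am (w n) + act A0 (w (n + 1)) + act Ap (w (n + 2))) i =
      g (n + 1) i by rw [sub_eq_iff_eq_add', ← Pi.add_apply, ← h1]] at h

lemma act_const {M : Matrix (Fin m) (Fin m) ℝ} (hM : M *ᵥ 1 = 1) (c : 𝕜) :
    act M (fun _ => c) = fun _ => c := by
  ext i
  rw [act_apply, ← Finset.sum_smul, ← mulVec_one_apply, hM, Pi.one_apply, one_smul]

/-- The vectors `ω_r` solve the Poisson equation as soon as `γ` solves the equation of the
censored process on level `0`. -/
lemma solvesPoisson_omegaVec (hP : IsStochastic (transition B Am A0 Ap))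
    (hc : Connected Am A0 Ap) (hG : IsG Am A0 Ap G) (hR : IsR Am A0 Ap R)
    (hs : ∀ n, Summable fun k => act (R ^ k) (g (n + k)))
    (hγ : act (1 - pStar B Ap G) (gammaVec B Ap G R g) = tailSum R g 0) (c : 𝕜) :
    SolvesPoisson (transition B Am A0 Ap)
      (fun x => omegaVec B Am A0 Ap G R g c x.1 x.2) (fun x => g x.1 x.2) := by
  have hb := stochasticBlocks_of_transition hP
  obtain ⟨hUV, hVu, hRN, hGN⟩ := matU_eq_and hb hc hG hR
  have hd := (Matrix.isUnit_iff_isUnit_det _).1 hVu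
  have hM : (matU Am A0 R - 1)⁻¹ = -(1 - taboo A0 Ap G)⁻¹ := by
    refine Matrix.inv_eq_right_inv ?_
    rw [hUV, mul_neg, ← neg_mul, neg_sub, Matrix.mul_nonsing_inv _ hd]
  set V := taboo A0 Ap G with hV
  set y := yVec Am A0 G R g with hy
  set γ := gammaVec B Ap G R g with hγdef
  set s := tailSum R g with hsdef
  have hy0 : y 0 = 0 := yVec_zero
  have hysucc : ∀ r, y (r + 1) = act (1 - V)⁻¹ (s (r + 1)) + act G (y r) := fun r => by
    rw [hy, yVec_succ hs, hM, neg_act, neg_neg]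
  -- The recursion for `y` multiplied by `A₁` and by `1 - V`, using `A₁(1 - V)⁻¹ = R` and `(1 - V)G
  -- = A₋₁`.
  have hApy : ∀ r, act Ap (y (r + 1)) = act R (s (r + 1)) + act (Ap * G) (y r) := fun r => by
    rw [hysucc, act_add, ← mul_act, ← mul_act, ← hRN]
  have hVy : ∀ r, act (1 - V) (y (r + 1)) = s (r + 1) + act Am (y r) := fun r => by
    have h2 : (1 - V) * G = Am := by rw [hGN, Matrix.mul_nonsing_inv_cancel_left _ _ hd]
    rw [hysucc, act_add, ← mul_act, ← mul_act, Matrix.mul_nonsing_inv _ hd, one_act, h2]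
  have hω : ∀ r, omegaVec B Am A0 Ap G R g c r = act (G ^ r) γ + y r + fun _ => c := fun _ => rfl
  refine solvesPoisson_of_rows ?_ fun n => ?_
  · have hcc : act B (fun _ => c) + act Ap (fun _ => c) = fun _ => c := by
      rw [← add_act, act_const (by rw [Matrix.add_mulVec, boundary_row_sum hP])]
    have h1 := hApy 0
    have h2 := tailSum_eq hs 0
    rw [hy0, (by ext; simp [act_apply] : act (Ap * G) (0 : Fin m → 𝕜) = 0), add_zero] at h1
    rw [pStar, sub_act, one_act, add_act, mul_act] at hγ
    simp only [hω, pow_zero, pow_one, one_act, hy0, add_zero, act_add]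
    rw [h1]
    rw [← hsdef, ← hγ] at h2
    linear_combination (exp := 1) h2 - hcc
  · have hcc : act Am (fun _ => c) + act A0 (fun _ => c) + act Ap (fun _ => c) = fun _ => c := by
      rw [← add_act, ← add_act,
        act_const (by rw [Matrix.add_mulVec, Matrix.add_mulVec, hb.row_sum])]
    have h1 := hApy (n + 1)
    have h2 := tailSum_eq hs (n + 1)
    have h3 := hVy n
    have h4 := congrArg (fun M => act M γ) (G_pow_succ hG n)
    simp only [add_act, mul_act] at h4 h1
    rw [hV, taboo, sub_act, one_act, add_act, mul_act] at h3
    simp only [hω, act_add]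
    -- The parts in `γ` cancel by `h4`, those in `y` by `h3` and `h1`; what remains is `s_{n+1} =
    -- g_{n+1} + R s_{n+2}`.
    linear_combination (exp := 1) h4 + h3 - h1 + h2 - hcc

end Poisson

end QBD

theorem lemma6p2 {𝕜 : Type*} [RCLike 𝕜] {m : ℕ}
    (B Am A0 Ap G R : Matrix (Fin m) (Fin m) ℝ) (g : ℕ → Fin m → 𝕜)
    (hP : QBD.IsStochastic (QBD.transition B Am A0 Ap))
    (hPirr : (QBD.transition B Am A0 Ap).IsIrreducible)
    (hAirr : (Am + A0 + Ap).IsIrreducible)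
    (hfinal : QBD.OneFinalClass Am A0 Ap)
    (hG : QBD.IsG Am A0 Ap G)
    (hR : QBD.IsR Am A0 Ap R)
    (hg : Summable (fun k : ℕ => QBD.specRadius R ^ k * ‖g k‖))
    (hrec : QBD.IsRecurrent (QBD.transition B Am A0 Ap) →
      ∀ p : Fin m → ℝ, QBD.IsStationaryDistribution (QBD.pStar B Ap G) p →
        ∑ i, p i • (∑' k, QBD.act (R ^ k) (g k)) i = 0) :
    IsUnit (QBD.matU Am A0 R - 1) ∧
    QBD.IsGroupInverse (1 - QBD.pStar B Ap G) (QBD.groupInverse (1 - QBD.pStar B Ap G)) ∧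
    Summable (fun k => QBD.act (R ^ k) (g k)) ∧
    (∀ r, Summable (fun k => QBD.yTerm Am A0 G R g r k)) ∧
    ∀ c : 𝕜, QBD.SolvesPoisson (QBD.transition B Am A0 Ap)
      (fun x => QBD.omegaVec B Am A0 Ap G R g c x.1 x.2) (fun x => g x.1 x.2) := by
  have hb := QBD.stochasticBlocks_of_transition hP
  have hc := QBD.connected_of_oneFinalClass hb hAirr hfinal
  obtain ⟨hUV, hVu, -, -⟩ := QBD.matU_eq_and hb hc hG hR
  have hs := QBD.summable_act_pow_shift hR.1 (QBD.R_cyclic_reaches hb hc hR) hg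
  have hclosed : ∀ S : Set (Fin m), (∀ i ∈ S, ∀ j, 0 < QBD.pStar B Ap G i j → j ∈ S) →
      ∀ i ∈ S, ∀ j, j ∈ S := fun S hS i hi j =>
    QBD.pStar_closed hb (QBD.boundary_nonneg hP) hPirr hG hS hi j
  have hne : Nonempty (Fin m) := let ⟨_, ⟨e, _⟩, _⟩ := hfinal; ⟨e⟩
  have hS0 : ∑' k, QBD.act (R ^ k) (g k) = QBD.tailSum R g 0 := by simp [QBD.tailSum]
  -- All that is needed of the group inverse is that `(1 - P⁎)D` fixes `s_0`.
  obtain ⟨D, hD, hDS⟩ : ∃ D, QBD.IsGroupInverse (1 - QBD.pStar B Ap G) D ∧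
      QBD.act ((1 - QBD.pStar B Ap G) * D) (QBD.tailSum R g 0) = QBD.tailSum R g 0 := by
    by_cases h1 : QBD.pStar B Ap G *ᵥ 1 = 1
    · obtain ⟨p, D, hp, hD, hHD⟩ :=
        QBD.exists_isGroupInverse hne (QBD.pStar_nonneg hP hG) h1 hclosed
      refine ⟨D, hD, ?_⟩
      have h0 := hrec (QBD.isRecurrent_of_pStar hP hPirr hc hG h1) p hp
      rw [hS0] at h0
      rw [hHD, QBD.sub_act, QBD.one_act, sub_eq_self]
      ext i
      simpa [QBD.act_apply, Matrix.vecMulVec_apply] using h0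
    · have hu : IsUnit (1 - QBD.pStar B Ap G) := by
        refine QBD.isUnit_one_sub (QBD.pStar_nonneg hP hG) (QBD.pStar_row_sum_le hP hG) ?_
        -- A nonempty trap would contain all phases, giving `P⁎1 = 1`.
        intro S hS hS1
        by_contra hSne
        obtain ⟨i, hi⟩ := Set.nonempty_iff_ne_empty.2 hSne
        refine h1 (funext fun j => ?_)
        rw [QBD.mulVec_one_apply, hS1 j (hclosed S hS i hi j), Pi.one_apply]
      refine ⟨_, QBD.isGroupInverse_inv hu, ?_⟩
      rw [Matrix.mul_nonsing_inv _ ((Matrix.isUnit_iff_isUnit_det _).1 hu), QBD.one_act]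
  have hinv := QBD.isGroupInverse_groupInverse hD
  refine ⟨?_, hinv, by simpa using hs 0, fun r => (QBD.hasSum_yTerm hs r).summable,
    QBD.solvesPoisson_omegaVec hP hc hG hR hs ?_⟩
  · rw [hUV, ← neg_sub, IsUnit.neg_iff]
    exact hVu
  -- With `H = 1 - P⁎`: `HH^# s_0 = HH^#HD s_0 = HD s_0 = s_0`, so uniqueness of the group inverse
  -- is not needed.
  · rw [QBD.gammaVec, hS0]
    nth_rw 1 [← hDS]
    rw [← QBD.mul_act, ← QBD.mul_act, ← mul_assoc, hinv.2.1, hDS]
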